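/- Let $n\in\mathbb N$. For multi-indices $\alpha,\beta$ and $\langle\xi\rangle:=(1+|\xi|^2)^{1/2}$, let $SO_0^{-1}$ be the set of all $c\in C^\infty(\mathbb R^n\times\mathbb R^n)$ (complex-valued) such that for all multi-indices $\alpha,\beta$ there is a constant $C_{\alpha,\beta}$ with $$|\partial_\xi^\alpha\partial_x^\beta c(x,\xi)|\le C_{\alpha,\beta}\,\langle\xi\rangle^{-1-|\alpha|}\qquad(x,\xi\in\mathbb R^n),$$ and there is a function $K_{\alpha,\beta}:\mathbb R^n\to\mathbb R$ with $$|\partial_\xi^\alpha\partial_x^\beta c(x,\xi)|\le K_{\alpha,\beta}(x)\,\langle\xi\rangle^{-1-|\alpha|}\qquad(x,\xi\in\mathbb R^n),\qquad \lim_{x\to\infty}K_{\alpha,\beta}(x)=0.$$ For $u\in C_0^\infty(\mathbb R^n)$ put $$(\mathrm{Op}(c)u)(x):=\frac1{(2\pi)^n}\int_{\mathbb R^n}d\xi\int_{\mathbb R^n}c(x,\xi)u(y)e^{i\langle x-y,\xi\rangle}\,dy .$$ **Proposition.** Let $1<q<\infty$ and $c\in SO_0^{-1}$. Then $\mathrm{Op}(c)$,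 defined on $C_0^\infty(\mathbb R^n)$, extends uniquely to a bounded linear operator on $L^q(\mathbb R^n)$, and this operator is compact. -/

import Mathlib

open MeasureTheory Filter Topology
open scoped ContDiff ENNReal

noncomputable section

namespace PDO

/-- The first order partial derivative `∂_j f` of a function on `ℝⁿ`. -/
def partialDeriv {n : ℕ} (j : Fin n) (f : EuclideanSpace ℝ (Fin n) → ℂ) :
    EuclideanSpace ℝ (Fin n) → ℂ :=
  fun x => fderiv ℝ f x (EuclideanSpace.single j 1)

/-- For a multi-index `α`, the derivative `∂^α f = ∂_1^{α_1} ⋯ ∂_n^{α_n} f`. -/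
def multiDeriv {n : ℕ} (α : Fin n → ℕ) (f : EuclideanSpace ℝ (Fin n) → ℂ) :
    EuclideanSpace ℝ (Fin n) → ℂ :=
  (List.finRange n).foldr (fun j g => (partialDeriv j)^[α j] g) f

/-- The length `|α| = α_1 + ⋯ + α_n` of a multi-index. -/
def multiLength {n : ℕ} (α : Fin n → ℕ) : ℕ := ∑ j, α j

/-- The mixed derivative `∂_ξ^α ∂_x^β a (x, ξ)` of a symbol. -/
def symbolDeriv {n : ℕ} (α β : Fin n → ℕ)
    (a : EuclideanSpace ℝ (Fin n) → EuclideanSpace ℝ (Fin n) → ℂ)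
    (x ξ : EuclideanSpace ℝ (Fin n)) : ℂ :=
  multiDeriv α (fun η => multiDeriv β (fun y => a y η) x) ξ

/-- The Japanese bracket `⟨ξ⟩ = (1 + |ξ|²)^{1/2}`. -/
def japaneseBracket {n : ℕ} (ξ : EuclideanSpace ℝ (Fin n)) : ℝ := Real.sqrt (1 + ‖ξ‖ ^ 2)

/-- The Hörmander class `S^m_{ρ,δ}`. -/
structure IsHormanderSymbol {n : ℕ} (m ρ δ : ℝ)
    (a : EuclideanSpace ℝ (Fin n) → EuclideanSpace ℝ (Fin n) → ℂ) : Prop where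
  smooth : ContDiff ℝ ∞
    (fun p : EuclideanSpace ℝ (Fin n) × EuclideanSpace ℝ (Fin n) => a p.1 p.2)
  bound : ∀ α β : Fin n → ℕ, ∃ C : ℝ, ∀ x ξ : EuclideanSpace ℝ (Fin n),
    ‖symbolDeriv α β a x ξ‖ ≤
      C * japaneseBracket ξ ^ (m - ρ * (multiLength α : ℝ) + δ * (multiLength β : ℝ))

/-- `|∂_ξ^α ∂_x^β a (x, ξ)| ≤ C(x) ⟨ξ⟩^{m - |α|}` with some function `C` that tends to `0` at
infinity. -/
def DecaysAtInfinity {n : ℕ} (m : ℝ) (α β : Fin n → ℕ)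
    (a : EuclideanSpace ℝ (Fin n) → EuclideanSpace ℝ (Fin n) → ℂ) : Prop :=
  ∃ C : EuclideanSpace ℝ (Fin n) → ℝ,
    (∀ x ξ, ‖symbolDeriv α β a x ξ‖ ≤ C x * japaneseBracket ξ ^ (m - (multiLength α : ℝ))) ∧
    Tendsto C (cocompact (EuclideanSpace ℝ (Fin n))) (𝓝 0)

/-- The class `SO^m` of symbols that are slowly oscillating at infinity in the first variable. -/
structure IsSO {n : ℕ} (m : ℝ)
    (a : EuclideanSpace ℝ (Fin n) → EuclideanSpace ℝ (Fin n) → ℂ) : Prop where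
  symbol : IsHormanderSymbol m 1 0 a
  decay : ∀ α β : Fin n → ℕ, β ≠ 0 → DecaysAtInfinity m α β a

/-- The class `SO_0^m`: the decay at infinity holds for all multi-indices, including `β = 0`. -/
structure IsSO₀ {n : ℕ} (m : ℝ)
    (a : EuclideanSpace ℝ (Fin n) → EuclideanSpace ℝ (Fin n) → ℂ) : Prop where
  isSO : IsSO m a
  decay : ∀ α β : Fin n → ℕ, DecaysAtInfinity m α β a

/-- The pseudodifferential operator
`(Op(a) u)(x) = (2π)^{-n} ∫ dξ ∫ a(x, ξ) u(y) e^{i⟨x - y, ξ⟩} dy`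
(applied to smooth compactly supported `u`). -/
def Op {n : ℕ} (a : EuclideanSpace ℝ (Fin n) → EuclideanSpace ℝ (Fin n) → ℂ)
    (u : EuclideanSpace ℝ (Fin n) → ℂ) (x : EuclideanSpace ℝ (Fin n)) : ℂ :=
  (1 / (2 * (Real.pi : ℂ)) ^ n) *
    ∫ ξ : EuclideanSpace ℝ (Fin n), ∫ y : EuclideanSpace ℝ (Fin n),
      a x ξ * u y * Complex.exp (Complex.I * ((inner ℝ (x - y) ξ : ℝ) : ℂ))

/-- The bounded operator `T` on `L^q(ℝⁿ)` is an extension of `Op(a)`, given on `C_0^∞(ℝⁿ)`. -/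
def ExtendsOp {n : ℕ} {q : ℝ≥0∞} [Fact (1 ≤ q)]
    (a : EuclideanSpace ℝ (Fin n) → EuclideanSpace ℝ (Fin n) → ℂ)
    (T : Lp ℂ q (volume : Measure (EuclideanSpace ℝ (Fin n))) →L[ℂ]
      Lp ℂ q (volume : Measure (EuclideanSpace ℝ (Fin n)))) : Prop :=
  ∀ (u : EuclideanSpace ℝ (Fin n) → ℂ) (hu : ContDiff ℝ ∞ u) (hc : HasCompactSupport u),
    T ((hu.continuous.memLp_of_hasCompactSupport hc).toLp u) =ᵐ[volume] Op a u

end PDO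

end

/-!
Since the symbol has negative order, `Op(c)` is an integral operator with a kernel dominated by an
integrable convolution kernel, and no singular integral theory is needed.

Cut the frequency space dyadically by a smooth partition of unity. The piece of `Op(c)` at
frequencies of size `R = 2 ^ j` has a continuous kernel `G(x, y)`, and integrating by parts `n + 1`
times in the oscillatory integral that defines it gives
`|G(x, y)| ≤ C M(x) R⁻¹ R ^ n (1 + R |x - y|) ^ (-n - 1)`, where `M` collects the constants in
finitely many symbol estimates; by the definition of the symbol class, `M` may be taken bounded
and vanishing at infinity (`IsSO₀.exists_bound`, `exists_norm_integral_exp_dilate_le`).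

Schur's test (`IsDominatedKernel.exists_isIntegralOperator`) turns this into a bound `O(R⁻¹)` on
`L^q`. Each piece is compact (`IsIntegralOperator.isCompactOperator`): because `M` vanishes at
infinity and the majorant is integrable, the kernel may be truncated to a compact set up to a small
error in norm, and there it is uniformly close to kernels that are simple in `x`, which have finite
rank. The norms `O(2 ^ (-j))` are summable, so the sum of the pieces is compact. On test functions
it agrees with `Op(c)` by Fubini's theorem and dominated convergence, and uniqueness is the density
of the test functions in `L^q`, `q < ∞`.
-/

namespace PDO

/-! ### Schur's test for integral operators -/

section IntegralOperators

variable {E : Type*} [NormedAddCommGroup E] [InnerProductSpace ℝ E] [FiniteDimensional ℝ E]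
  [MeasurableSpace E] [BorelSpace E]

/-- Young's inequality `‖h ∗ f‖_p ≤ ‖h‖_1 ‖f‖_p`, raised to the power `p`. -/
theorem lintegral_rpow_lintegral_sub_mul_le {p : ℝ} (hp : 1 < p) {h f : E → ℝ≥0∞}
    (hh : Measurable h) (hf : Measurable f) :
    ∫⁻ x, (∫⁻ y, h (x - y) * f y) ^ p ≤ (∫⁻ z, h z) ^ p * ∫⁻ y, f y ^ p := by
  have hp0 : 0 < p := by linarith
  have hpq : (Real.conjExponent p).HolderConjugate p :=
    (Real.HolderConjugate.conjExponent hp).symm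
  set p' := Real.conjExponent p
  have hp'0 : 0 < p' := hpq.pos
  have hexp : p / p' = p - 1 := by
    have := hpq.inv_add_inv_eq_one
    field_simp at this ⊢
    linarith
  have hA : ∀ x, ∫⁻ y, h (x - y) = ∫⁻ z, h z := fun x => lintegral_sub_left_eq_self h x
  have key : ∀ x, (∫⁻ y, h (x - y) * f y) ^ p
      ≤ (∫⁻ z, h z) ^ (p - 1) * ∫⁻ y, h (x - y) * f y ^ p := by
    intro x
    have hm : Measurable fun y => h (x - y) := hh.comp (measurable_const.sub measurable_id)
    -- Hölder's inequality for the splitting `h = h ^ (1 / p') * h ^ (1 / p)`.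
    have h1 := ENNReal.lintegral_mul_le_Lp_mul_Lq volume hpq
      (f := fun y => h (x - y) ^ (1 / p')) (g := fun y => h (x - y) ^ (1 / p) * f y)
      (hm.pow_const _).aemeasurable ((hm.pow_const _).mul hf).aemeasurable
    have e1 : ∀ y, h (x - y) ^ (1 / p') * (h (x - y) ^ (1 / p) * f y) = h (x - y) * f y := by
      intro y
      rw [← mul_assoc, ← ENNReal.rpow_add_of_nonneg _ _ (by positivity) (by positivity)]
      have : 1 / p' + 1 / p = 1 := by simpa using hpq.inv_add_inv_eq_one
      rw [this, ENNReal.rpow_one]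
    have e2 : ∀ y, (h (x - y) ^ (1 / p')) ^ p' = h (x - y) := by
      intro y
      rw [← ENNReal.rpow_mul, one_div_mul_cancel hp'0.ne', ENNReal.rpow_one]
    have e3 : ∀ y, (h (x - y) ^ (1 / p) * f y) ^ p = h (x - y) * f y ^ p := by
      intro y
      rw [ENNReal.mul_rpow_of_nonneg _ _ hp0.le, ← ENNReal.rpow_mul,
        one_div_mul_cancel hp0.ne', ENNReal.rpow_one]
    simp only [Pi.mul_apply, e1, e2, e3, hA] at h1
    calc (∫⁻ y, h (x - y) * f y) ^ p
        ≤ ((∫⁻ z, h z) ^ (1 / p') * (∫⁻ y, h (x - y) * f y ^ p) ^ (1 / p)) ^ p := by gcongr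
      _ = (∫⁻ z, h z) ^ (p - 1) * ∫⁻ y, h (x - y) * f y ^ p := by
        rw [ENNReal.mul_rpow_of_nonneg _ _ hp0.le, ← ENNReal.rpow_mul, ← ENNReal.rpow_mul,
          one_div_mul_cancel hp0.ne', ENNReal.rpow_one, ← hexp]
        congr 2
        ring
  have hm2 : Measurable fun z : E × E => h (z.1 - z.2) * f z.2 ^ p :=
    (hh.comp (measurable_fst.sub measurable_snd)).mul ((hf.comp measurable_snd).pow_const _)
  calc ∫⁻ x, (∫⁻ y, h (x - y) * f y) ^ p
      ≤ ∫⁻ x, (∫⁻ z, h z) ^ (p - 1) * ∫⁻ y, h (x - y) * f y ^ p := lintegral_mono key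
    _ = (∫⁻ z, h z) ^ (p - 1) * ∫⁻ x, ∫⁻ y, h (x - y) * f y ^ p :=
        lintegral_const_mul _ hm2.lintegral_prod_right'
    _ = (∫⁻ z, h z) ^ (p - 1) * ∫⁻ y, ∫⁻ x, h (x - y) * f y ^ p := by
        rw [lintegral_lintegral_swap hm2.aemeasurable]
    _ = (∫⁻ z, h z) ^ (p - 1) * ((∫⁻ z, h z) * ∫⁻ y, f y ^ p) := by
        congr 1
        rw [← lintegral_const_mul _ (hf.pow_const _)]
        refine lintegral_congr fun y => ?_
        rw [lintegral_mul_const _ (show Measurable fun x => h (x - y) by fun_prop)]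
        congr 1
        exact lintegral_sub_right_eq_self h y
    _ = (∫⁻ z, h z) ^ p * ∫⁻ y, f y ^ p := by
        rw [← mul_assoc]
        congr 1
        conv_lhs => rw [← ENNReal.rpow_one (∫⁻ z, h z), ← ENNReal.rpow_mul, one_mul,
          ← ENNReal.rpow_add_of_nonneg _ _ (by linarith) zero_le_one, sub_add_cancel]

/-- `T` is the integral operator on `L^q` with kernel `G`. -/
def IsIntegralOperator {q : ℝ≥0∞} [Fact (1 ≤ q)] (G : E → E → ℂ)
    (T : Lp ℂ q (volume : Measure E) →L[ℂ] Lp ℂ q (volume : Measure E)) : Prop :=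
  ∀ f : Lp ℂ q (volume : Measure E), T f =ᵐ[volume] fun x => ∫ y, G x y * f y

/-- The kernel `G` is dominated by the convolution kernel of an integrable function `h`. -/
structure IsDominatedKernel (G : E → E → ℂ) (h : E → ℝ) : Prop where
  measurable : Measurable (Function.uncurry G)
  measurable_majorant : Measurable h
  integrable_majorant : Integrable h
  norm_le : ∀ x y, ‖G x y‖ ≤ h (x - y)

namespace IsDominatedKernel

variable {G G₁ G₂ : E → E → ℂ} {h h₁ h₂ : E → ℝ}

theorem majorant_nonneg (hG : IsDominatedKernel G h) (z : E) : 0 ≤ h z := by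
  simpa using (norm_nonneg _).trans (hG.norm_le z 0)

theorem enorm_le (hG : IsDominatedKernel G h) (x y : E) :
    ‖G x y‖ₑ ≤ ENNReal.ofReal (h (x - y)) := by
  rw [← ofReal_norm]
  exact ENNReal.ofReal_le_ofReal (hG.norm_le x y)

theorem lintegral_majorant (hG : IsDominatedKernel G h) :
    ∫⁻ z, ENNReal.ofReal (h z) = ENNReal.ofReal (∫ z, h z) :=
  (ofReal_integral_eq_lintegral_ofReal hG.integrable_majorant
    (ae_of_all _ hG.majorant_nonneg)).symm

theorem lintegral_rpow_le (hG : IsDominatedKernel G h) {q : ℝ≥0∞} (hq₁ : 1 < q) (hq : q < ⊤)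
    (f : E → ℂ) (hf : StronglyMeasurable f) :
    (∫⁻ x, (∫⁻ y, ‖G x y * f y‖ₑ) ^ q.toReal) ^ (1 / q.toReal)
      ≤ ENNReal.ofReal (∫ z, h z) * eLpNorm f q volume := by
  have hq0 : q ≠ 0 := (zero_lt_one.trans hq₁).ne'
  have hp : 1 < q.toReal := by
    simpa using (ENNReal.toReal_lt_toReal ENNReal.one_ne_top hq.ne).2 hq₁
  have hp0 : 0 < q.toReal := by linarith
  rw [eLpNorm_eq_lintegral_rpow_enorm_toReal hq0 hq.ne, ← hG.lintegral_majorant]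
  calc (∫⁻ x, (∫⁻ y, ‖G x y * f y‖ₑ) ^ q.toReal) ^ (1 / q.toReal)
      ≤ (∫⁻ x, (∫⁻ y, ENNReal.ofReal (h (x - y)) * ‖f y‖ₑ) ^ q.toReal) ^ (1 / q.toReal) := by
        gcongr with x y
        rw [enorm_mul]
        gcongr
        exact hG.enorm_le x y
    _ ≤ ((∫⁻ z, ENNReal.ofReal (h z)) ^ q.toReal * ∫⁻ y, ‖f y‖ₑ ^ q.toReal) ^ (1 / q.toReal) := by
        gcongr
        exact lintegral_rpow_lintegral_sub_mul_le hp
          (h := fun z => ENNReal.ofReal (h z)) hG.measurable_majorant.ennreal_ofReal hf.enorm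
    _ = _ := by
        rw [ENNReal.mul_rpow_of_nonneg _ _ (by positivity), ← ENNReal.rpow_mul,
          mul_one_div_cancel hp0.ne', ENNReal.rpow_one]

theorem measurable_mul (hG : IsDominatedKernel G h) {f : E → ℂ} (hf : StronglyMeasurable f) :
    Measurable fun z : E × E => G z.1 z.2 * f z.2 :=
  hG.measurable.mul (hf.measurable.comp measurable_snd)

theorem ae_integrable (hG : IsDominatedKernel G h) {q : ℝ≥0∞} (hq₁ : 1 < q) (hq : q < ⊤)
    (f : Lp ℂ q (volume : Measure E)) : ∀ᵐ x, Integrable fun y => G x y * f y := by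
  have hp0 : 0 < q.toReal := ENNReal.toReal_pos (zero_lt_one.trans hq₁).ne' hq.ne
  have hf := Lp.stronglyMeasurable f
  have hm := (hG.measurable_mul hf).enorm
  have hfin : ∫⁻ x, (∫⁻ y, ‖G x y * f y‖ₑ) ^ q.toReal ≠ ⊤ := by
    intro htop
    have h1 := hG.lintegral_rpow_le hq₁ hq f hf
    rw [htop, ENNReal.top_rpow_of_pos (by positivity)] at h1
    exact (ENNReal.mul_lt_top ENNReal.ofReal_lt_top (Lp.eLpNorm_lt_top f)).ne (top_le_iff.1 h1)
  filter_upwards [ae_lt_top (hm.lintegral_prod_right'.pow_const _) hfin] with x hx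
  refine ⟨((hG.measurable_mul hf).comp measurable_prodMk_left).aestronglyMeasurable, ?_⟩
  by_contra hne
  have : ∫⁻ y, ‖G x y * f y‖ₑ = ⊤ := by
    simpa [HasFiniteIntegral] using hne
  rw [this, ENNReal.top_rpow_of_pos hp0] at hx
  exact lt_irrefl _ hx

theorem eLpNorm_integral_le (hG : IsDominatedKernel G h) {q : ℝ≥0∞} (hq₁ : 1 < q) (hq : q < ⊤)
    (f : Lp ℂ q (volume : Measure E)) :
    eLpNorm (fun x => ∫ y, G x y * f y) q volume
      ≤ ENNReal.ofReal (∫ z, h z) * eLpNorm f q volume := by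
  refine le_trans ?_ (hG.lintegral_rpow_le hq₁ hq f (Lp.stronglyMeasurable f))
  rw [eLpNorm_eq_lintegral_rpow_enorm_toReal (zero_lt_one.trans hq₁).ne' hq.ne]
  gcongr with x
  exact enorm_integral_le_lintegral_enorm _

theorem memLp_integral (hG : IsDominatedKernel G h) {q : ℝ≥0∞} (hq₁ : 1 < q) (hq : q < ⊤)
    (f : Lp ℂ q (volume : Measure E)) : MemLp (fun x => ∫ y, G x y * f y) q volume :=
  ⟨((hG.measurable_mul (Lp.stronglyMeasurable f)).stronglyMeasurable.integral_prod_right'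
      (ν := volume)).aestronglyMeasurable,
    (hG.eLpNorm_integral_le hq₁ hq f).trans_lt
      (ENNReal.mul_lt_top ENNReal.ofReal_lt_top (Lp.eLpNorm_lt_top f))⟩

/-- Schur's test: a dominated kernel defines a bounded operator on `L^q`, with norm at most the
`L¹` norm of the majorant. -/
theorem exists_isIntegralOperator (hG : IsDominatedKernel G h) {q : ℝ≥0∞} [Fact (1 ≤ q)]
    (hq₁ : 1 < q) (hq : q < ⊤) :
    ∃ T : Lp ℂ q (volume : Measure E) →L[ℂ] Lp ℂ q (volume : Measure E),
      IsIntegralOperator G T ∧ ‖T‖ ≤ ∫ z, h z := by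
  let L : Lp ℂ q (volume : Measure E) →ₗ[ℂ] Lp ℂ q (volume : Measure E) :=
    { toFun := fun f => (hG.memLp_integral hq₁ hq f).toLp _
      map_add' := by
        intro f g
        rw [← MemLp.toLp_add]
        refine MemLp.toLp_congr _ _ ?_
        filter_upwards [hG.ae_integrable hq₁ hq f, hG.ae_integrable hq₁ hq g] with x hf hg
        rw [Pi.add_apply, ← integral_add hf hg]
        refine integral_congr_ae ?_
        filter_upwards [Lp.coeFn_add f g] with y hy
        rw [hy, Pi.add_apply, mul_add]
      map_smul' := by
        intro a f
        rw [RingHom.id_apply, ← MemLp.toLp_const_smul]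
        refine MemLp.toLp_congr _ _ (ae_of_all _ fun x => ?_)
        simp only [Pi.smul_apply]
        rw [← integral_smul]
        refine integral_congr_ae ?_
        filter_upwards [Lp.coeFn_smul a f] with y hy
        rw [hy, Pi.smul_apply, smul_eq_mul, smul_eq_mul]
        ring }
  have hL : ∀ f, ‖L f‖ ≤ (∫ z, h z) * ‖f‖ := by
    intro f
    change ‖(hG.memLp_integral hq₁ hq f).toLp _‖ ≤ _
    rw [Lp.norm_toLp, Lp.norm_def]
    have h0 : 0 ≤ ∫ z, h z := integral_nonneg hG.majorant_nonneg
    have h1 := ENNReal.toReal_mono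
      (ENNReal.mul_lt_top ENNReal.ofReal_lt_top (Lp.eLpNorm_lt_top f)).ne
      (hG.eLpNorm_integral_le hq₁ hq f)
    rwa [ENNReal.toReal_mul, ENNReal.toReal_ofReal h0] at h1
  refine ⟨L.mkContinuous _ hL, fun f => ?_,
    L.mkContinuous_norm_le (integral_nonneg hG.majorant_nonneg) hL⟩
  exact MemLp.coeFn_toLp (hG.memLp_integral hq₁ hq f)

theorem norm_sub_le {q : ℝ≥0∞} [Fact (1 ≤ q)] (hq₁ : 1 < q) (hq : q < ⊤)
    (hG₁ : IsDominatedKernel G₁ h₁) (hG₂ : IsDominatedKernel G₂ h₂)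
    (hG : IsDominatedKernel (fun x y => G₁ x y - G₂ x y) h)
    {T₁ T₂ : Lp ℂ q (volume : Measure E) →L[ℂ] Lp ℂ q (volume : Measure E)}
    (hT₁ : IsIntegralOperator G₁ T₁) (hT₂ : IsIntegralOperator G₂ T₂) :
    ‖T₁ - T₂‖ ≤ ∫ z, h z := by
  obtain ⟨T, hT, hTn⟩ := hG.exists_isIntegralOperator hq₁ hq
  suffices T₁ - T₂ = T by rwa [this]
  refine ContinuousLinearMap.ext fun f => Lp.ext ?_
  rw [sub_apply]
  filter_upwards [Lp.coeFn_sub (T₁ f) (T₂ f), hT₁ f, hT₂ f, hT f, hG₁.ae_integrable hq₁ hq f,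
    hG₂.ae_integrable hq₁ hq f] with x h0 h1 h2 h3 i1 i2
  rw [h0, Pi.sub_apply, h1, h2, h3, ← integral_sub i1 i2]
  simp only [sub_mul]

end IsDominatedKernel

end IntegralOperators

/-! ### Compactness of integral operators -/

section Compactness

variable {E : Type*} [NormedAddCommGroup E] [InnerProductSpace ℝ E] [FiniteDimensional ℝ E]
  [MeasurableSpace E] [BorelSpace E]

theorem isCompactOperator_of_forall_mem {V : Type*} [NormedAddCommGroup V] [NormedSpace ℂ V]
    (T : V →L[ℂ] V) (W : Submodule ℂ V) [FiniteDimensional ℂ W] (hW : ∀ v, T v ∈ W) :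
    IsCompactOperator T := by
  have : ProperSpace W := FiniteDimensional.proper ℂ W
  have hK : IsCompactOperator (T.codRestrict W hW) :=
    isCompactOperator_of_locallyCompactSpace_dom (T.codRestrict W hW)
  exact hK.clm_comp W.subtypeL

/-- An integral operator whose kernel takes, as a function of the first variable, only finitely
many values `g v`, and vanishes for `x ∉ A`, has finite rank. -/
theorem IsIntegralOperator.isCompactOperator_of_simpleFunc {q : ℝ≥0∞} [Fact (1 ≤ q)]
    {α : Type*} {A : Set E} (hA : MeasurableSet A) (hAfin : volume A ≠ ⊤)
    (p : SimpleFunc E α) (g : α → E → ℂ)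
    {T : Lp ℂ q (volume : Measure E) →L[ℂ] Lp ℂ q (volume : Measure E)}
    (hT : IsIntegralOperator (fun x y => A.indicator (fun x => g (p x) y) x) T) :
    IsCompactOperator T := by
  classical
  have hm : ∀ v, MeasurableSet (A ∩ p ⁻¹' {v}) := fun v => hA.inter (p.measurableSet_fiber v)
  have hfin : ∀ v, volume (A ∩ p ⁻¹' {v}) ≠ ⊤ := fun v =>
    ((measure_mono Set.inter_subset_left).trans_lt hAfin.lt_top).ne
  let w : α → Lp ℂ q (volume : Measure E) := fun v => indicatorConstLp q (hm v) (hfin v) 1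
  let W : Submodule ℂ (Lp ℂ q (volume : Measure E)) :=
    Submodule.span ℂ ((p.range.image w : Finset _) : Set _)
  have : FiniteDimensional ℂ W := FiniteDimensional.span_finset ℂ _
  refine isCompactOperator_of_forall_mem T W fun f => ?_
  have hTf : T f = ∑ v ∈ p.range, (∫ y, g v y * f y) • w v := by
    refine Lp.ext ?_
    have hw : ∀ v, w v =ᵐ[volume] (A ∩ p ⁻¹' {v}).indicator fun _ => (1 : ℂ) := fun v =>
      indicatorConstLp_coeFn
    have hs : (∑ v ∈ p.range, (∫ y, g v y * f y) • w v : Lp ℂ q (volume : Measure E)) =ᵐ[volume]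
        fun x => ∑ v ∈ p.range, (∫ y, g v y * f y) * (A ∩ p ⁻¹' {v}).indicator (fun _ => 1) x := by
      refine (Lp.coeFn_finsetSum _ _).trans ?_
      have : ∀ᵐ x, ∀ v ∈ p.range, ((∫ y, g v y * f y) • w v : Lp ℂ q (volume : Measure E)) x
          = (∫ y, g v y * f y) * (A ∩ p ⁻¹' {v}).indicator (fun _ => 1) x := by
        rw [Finset.eventually_all]
        intro v _
        filter_upwards [hw v, Lp.coeFn_smul (∫ y, g v y * f y) (w v)] with x h1 h2
        rw [h2, Pi.smul_apply, h1, smul_eq_mul]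
      filter_upwards [this] with x hx
      rw [Finset.sum_apply]
      exact Finset.sum_congr rfl hx
    filter_upwards [hT f, hs] with x h1 h2
    rw [h1, h2]
    by_cases hx : x ∈ A
    · rw [Finset.sum_eq_single (p x)]
      · simp [hx]
      · intro v _ hv
        have : x ∉ A ∩ p ⁻¹' {v} := fun h => hv h.2.symm
        simp [Set.indicator_of_notMem this]
      · intro h
        exact absurd (SimpleFunc.mem_range_self p x) h
    · simp [hx]
  rw [hTf]
  exact Submodule.sum_mem _ fun v hv => Submodule.smul_mem _ _
    (Submodule.subset_span (Finset.mem_coe.2 (Finset.mem_image_of_mem _ hv)))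

/-- The identity map is uniformly approximated on a compact set by simple functions. -/
theorem exists_simpleFunc_dist_lt {X : Type*} [PseudoMetricSpace X] [MeasurableSpace X]
    [OpensMeasurableSpace X] [SecondCountableTopology X] [Nonempty X] {K : Set X} (hK : IsCompact K) {δ : ℝ} (hδ : 0 < δ) :
    ∃ p : SimpleFunc X X, ∀ x ∈ K, dist (p x) x < δ := by
  let e := TopologicalSpace.denseSeq X
  obtain ⟨t, ht⟩ := hK.elim_finite_subcover (fun k : ℕ => Metric.ball (e k) δ)
    (fun _ => Metric.isOpen_ball) fun x _ => by
      obtain ⟨k, hk⟩ := (TopologicalSpace.denseRange_denseSeq X).exists_dist_lt x hδ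
      exact Set.mem_iUnion.2 ⟨k, hk⟩
  refine ⟨SimpleFunc.nearestPt e (t.sup id), fun x hx => ?_⟩
  obtain ⟨k, hkt, hk⟩ := Set.mem_iUnion₂.1 (ht hx)
  have h1 := SimpleFunc.edist_nearestPt_le e x (Finset.le_sup (f := id) hkt)
  rw [id, edist_dist, edist_dist, ENNReal.ofReal_le_ofReal_iff dist_nonneg] at h1
  exact h1.trans_lt (by simpa [dist_comm] using hk)

theorem tendsto_setIntegral_norm_gt {k : E → ℝ} (hk : Integrable k) :
    Tendsto (fun n : ℕ => ∫ z in {z | (n : ℝ) < ‖z‖}, k z) atTop (𝓝 0) := by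
  have := tendsto_setIntegral_of_antitone (μ := volume) (f := k)
    (s := fun n : ℕ => {z : E | (n : ℝ) < ‖z‖})
    (fun n => measurableSet_lt measurable_const measurable_norm)
    (fun m n hmn z hz => by
      have hz' : (n : ℝ) < ‖z‖ := hz
      exact lt_of_le_of_lt (Nat.cast_le.2 hmn : (m : ℝ) ≤ n) hz') ⟨0, hk.integrableOn⟩
  have he : ⋂ n : ℕ, {z : E | (n : ℝ) < ‖z‖} = ∅ := by
    ext z
    simpa using exists_nat_ge ‖z‖
  simpa [he] using this

/-- A continuous kernel `G` with `|G(x, y)| ≤ M(x) k(x - y)`, where `k` is integrable and `M` is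
bounded and vanishes at infinity, defines a compact operator: it is the norm limit of operators
whose kernels are simple in `x`. -/
theorem IsIntegralOperator.isCompactOperator {q : ℝ≥0∞} [Fact (1 ≤ q)] (hq₁ : 1 < q) (hq : q < ⊤)
    {G : E → E → ℂ} (hG : Continuous (Function.uncurry G)) {M k : E → ℝ} {C : ℝ}
    (hMC : ∀ x, M x ≤ C) (hM : Tendsto M (cocompact E) (𝓝 0))
    (hk : Integrable k) (hkm : Measurable k) (hk0 : ∀ z, 0 ≤ k z)
    (hGk : ∀ x y, ‖G x y‖ ≤ M x * k (x - y))
    {T : Lp ℂ q (volume : Measure E) →L[ℂ] Lp ℂ q (volume : Measure E)}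
    (hT : IsIntegralOperator G T) : IsCompactOperator T := by
  have hGC : IsDominatedKernel G (fun z => C * k z) :=
    ⟨hG.measurable, hkm.const_mul C, hk.const_mul C, fun x y => (hGk x y).trans
      (mul_le_mul_of_nonneg_right (hMC x) (hk0 _))⟩
  -- It suffices to approximate within `ε * (∫ k + 2)`.
  suffices key : ∀ ε > 0, ∃ T' : Lp ℂ q (volume : Measure E) →L[ℂ] Lp ℂ q (volume : Measure E),
      IsCompactOperator T' ∧ ‖T - T'‖ ≤ ε * (∫ z, k z) + ε + ε by
    have hcl := isClosed_setOfPred_isCompactOperator (σ₁₂ := RingHom.id ℂ)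
      (M₁ := Lp ℂ q (volume : Measure E)) (M₂ := Lp ℂ q (volume : Measure E))
    refine hcl.closure_subset (Metric.mem_closure_iff.2 fun η hη => ?_)
    have hI : 0 ≤ ∫ z, k z := integral_nonneg hk0
    obtain ⟨T', hT', hn⟩ := key (η / ((∫ z, k z) + 3)) (by positivity)
    refine ⟨T', hT', ?_⟩
    rw [dist_eq_norm]
    refine hn.trans_lt ?_
    rw [show η / ((∫ z, k z) + 3) * (∫ z, k z) + η / ((∫ z, k z) + 3) + η / ((∫ z, k z) + 3)
      = η * (((∫ z, k z) + 2) / ((∫ z, k z) + 3)) by ring]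
    have : ((∫ z, k z) + 2) / ((∫ z, k z) + 3) < 1 := by
      rw [div_lt_one (by positivity)]; linarith
    nlinarith
  intro ε hε
  obtain ⟨r, hr0, hr⟩ : ∃ r : ℝ, 0 ≤ r ∧ ∀ x, r < ‖x‖ → M x ≤ ε := by
    have h1 : ∀ᶠ x in cocompact E, M x ≤ ε :=
      (hM.eventually (gt_mem_nhds hε)).mono fun x hx => hx.le
    rw [← Metric.cobounded_eq_cocompact] at h1
    obtain ⟨r, hr⟩ := (Metric.hasBasis_cobounded_compl_closedBall (0 : E)).eventually_iff.1 h1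
    refine ⟨max r 0, le_max_right _ _, fun x hx => hr.2 ?_⟩
    simpa using (le_max_left r 0).trans_lt hx
  obtain ⟨s, hs⟩ : ∃ s : ℕ, C * ∫ z in {z | (s : ℝ) < ‖z‖}, k z ≤ ε := by
    have h1 := (tendsto_setIntegral_norm_gt hk).const_mul C
    rw [mul_zero] at h1
    obtain ⟨s, hs⟩ := (h1.eventually (gt_mem_nhds hε)).exists
    exact ⟨s, hs.le⟩
  set ρ : ℝ := 2 * r + s with hρ
  set V : ℝ := volume.real (Metric.closedBall (0 : E) ρ) with hV
  have hV0 : 0 ≤ V := measureReal_nonneg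
  have hε' : 0 < ε / (V + 1) := by positivity
  have huc : UniformContinuousOn (Function.uncurry G)
      (Metric.closedBall (0 : E) (r + 1) ×ˢ Metric.closedBall (0 : E) (r + s)) :=
    ((isCompact_closedBall _ _).prod (isCompact_closedBall _ _)).uniformContinuousOn_of_continuous
      hG.continuousOn
  obtain ⟨δ, hδ, hδG⟩ := Metric.uniformContinuousOn_iff_le.1 huc _ hε'
  obtain ⟨p, hp⟩ := exists_simpleFunc_dist_lt (isCompact_closedBall (0 : E) r)
    (lt_min hδ one_pos)
  let A : Set E := Metric.closedBall 0 r
  let B : Set E := Metric.closedBall 0 (r + s)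
  -- The approximating kernel: truncated to `A ×ˢ B`, with `x` replaced by its approximation `p x`.
  let G' : E → E → ℂ := fun x y => A.indicator (fun x => B.indicator (G (p x)) y) x
  -- The three terms dominate `G - G'` for `x ∉ A`, for `x ∈ A` and `y ∉ B`, and on `A ×ˢ B`.
  let h : E → ℝ := fun z => ε * k z + {z : E | (s : ℝ) < ‖z‖}.indicator (fun z => C * k z) z
    + (Metric.closedBall (0 : E) ρ).indicator (fun _ => ε / (V + 1)) z
  have hC0 : ∀ z, 0 ≤ C * k z := hGC.majorant_nonneg
  have hms : MeasurableSet {z : E | (s : ℝ) < ‖z‖} :=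
    measurableSet_lt measurable_const measurable_norm
  have hi1 : Integrable (fun z => ε * k z) := hk.const_mul ε
  have hi2 : Integrable ({z : E | (s : ℝ) < ‖z‖}.indicator fun z => C * k z) :=
    (hk.const_mul C).indicator hms
  have hi3 : Integrable ((Metric.closedBall (0 : E) ρ).indicator fun _ => ε / (V + 1)) :=
    (integrable_indicator_iff Metric.isClosed_closedBall.measurableSet).2
      (integrableOn_const (measure_closedBall_lt_top.ne))
  have hhm : Measurable h :=
    ((hkm.const_mul ε).add ((hkm.const_mul C).indicator hms)).add
      (measurable_const.indicator Metric.isClosed_closedBall.measurableSet)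
  have hhi : Integrable h := (hi1.add hi2).add hi3
  have hint : ∫ z, h z ≤ ε * (∫ z, k z) + ε + ε := by
    have e1 : ∫ z, h z = ε * (∫ z, k z) + C * (∫ z in {z : E | (s : ℝ) < ‖z‖}, k z)
        + V * (ε / (V + 1)) := by
      have a1 := integral_add (hi1.add hi2) hi3
      have a2 := integral_add hi1 hi2
      simp only [Pi.add_apply] at a1
      rw [a1, a2, integral_const_mul,
        integral_indicator hms, integral_const_mul,
        integral_indicator Metric.isClosed_closedBall.measurableSet, setIntegral_const, smul_eq_mul]
    have e2 : V * (ε / (V + 1)) ≤ ε := by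
      rw [mul_div_assoc', div_le_iff₀ (by positivity)]
      nlinarith
    linarith
  have hAm : MeasurableSet A := Metric.isClosed_closedBall.measurableSet
  have hBm : MeasurableSet B := Metric.isClosed_closedBall.measurableSet
  have hG'm : Measurable (Function.uncurry G') := by
    have h1 : Measurable fun z : E × E => G (p z.1) z.2 :=
      hG.measurable.comp ((p.measurable.comp measurable_fst).prodMk measurable_snd)
    have h2 : Function.uncurry G' = (A ×ˢ B).indicator fun z : E × E => G (p z.1) z.2 := by
      ext ⟨x, y⟩
      by_cases hx : x ∈ A <;> by_cases hy : y ∈ B <;> simp [G', hx, hy]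
    rw [h2]
    exact h1.indicator (hAm.prod hBm)
  have hdiff : IsDominatedKernel (fun x y => G x y - G' x y) h := by
    refine ⟨hG.measurable.sub hG'm, hhm, hhi, fun x y => ?_⟩
    have p1 : 0 ≤ ε * k (x - y) := mul_nonneg hε.le (hk0 _)
    have p2 : 0 ≤ {z : E | (s : ℝ) < ‖z‖}.indicator (fun z => C * k z) (x - y) :=
      Set.indicator_nonneg (fun z _ => hC0 z) _
    have p3 : 0 ≤ (Metric.closedBall (0 : E) ρ).indicator (fun _ => ε / (V + 1)) (x - y) :=
      Set.indicator_nonneg (fun z _ => hε'.le) _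
    simp only [h]
    by_cases hx : x ∈ A
    · have hxr : ‖x‖ ≤ r := by simpa [A] using hx
      by_cases hy : y ∈ B
      · have hyr : ‖y‖ ≤ r + s := by simpa [B] using hy
        have hmem : x - y ∈ Metric.closedBall (0 : E) ρ := by
          rw [mem_closedBall_zero_iff]
          exact (norm_sub_le x y).trans (by linarith)
        have hpx := hp x hx
        have hpr : ‖p x‖ ≤ r + 1 := by
          have := norm_le_norm_add_norm_sub' (p x) x
          rw [dist_eq_norm] at hpx
          linarith [min_le_right δ 1]
        have := hδG (x, y) ⟨by simpa using hxr.trans (by linarith), hy⟩ (p x, y)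
          ⟨by simpa using hpr, hy⟩ (by
            rw [Prod.dist_eq]
            simpa [dist_comm x, hδ.le] using hpx.le.trans (min_le_left δ 1))
        rw [dist_eq_norm] at this
        simp only [G', Set.indicator_of_mem hx, Set.indicator_of_mem hy,
          Set.indicator_of_mem hmem]
        simp only [Function.uncurry_apply_pair] at this
        linarith
      · have hyr : r + s < ‖y‖ := by simpa [B] using hy
        have hmem : x - y ∈ {z : E | (s : ℝ) < ‖z‖} := by
          have := norm_sub_norm_le y x
          rw [norm_sub_rev] at this
          simp only [Set.mem_ofPred_eq]
          linarith
        rw [Set.indicator_of_mem hmem]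
        simp only [G', Set.indicator_of_mem hx, Set.indicator_of_notMem hy, sub_zero]
        linarith [hGC.norm_le x y]
    · have hxr : r < ‖x‖ := by simpa [A] using hx
      simp only [G', Set.indicator_of_notMem hx, sub_zero]
      have := mul_le_mul_of_nonneg_right (hr x hxr) (hk0 (x - y))
      linarith [hGk x y]
  have hG'd : IsDominatedKernel G' (fun z => C * k z + h z) := by
    refine ⟨hG'm, (hkm.const_mul C).add hhm, (hk.const_mul C).add hhi, fun x y => ?_⟩
    have h1 := norm_sub_le (G x y) (G x y - G' x y)
    rw [sub_sub_cancel] at h1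
    linarith [hGC.norm_le x y, hdiff.norm_le x y]
  obtain ⟨T', hT', -⟩ := hG'd.exists_isIntegralOperator hq₁ hq
  refine ⟨T', hT'.isCompactOperator_of_simpleFunc (A := A) hAm measure_closedBall_lt_top.ne p
    (fun v y => B.indicator (G v) y), ?_⟩
  exact (IsDominatedKernel.norm_sub_le hq₁ hq hGC hG'd hdiff hT hT').trans hint

end Compactness

/-! ### Iterated partial derivatives -/

section PartialDerivatives

variable {n : ℕ}

local notation "𝔼" => EuclideanSpace ℝ (Fin n)

theorem contDiff_partialDeriv {f : 𝔼 → ℂ} (hf : ContDiff ℝ ∞ f) (j : Fin n) :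
    ContDiff ℝ ∞ (partialDeriv j f) :=
  (hf.fderiv_right (m := ∞) (by simp)).clm_apply contDiff_const

theorem contDiff_iterate_partialDeriv {f : 𝔼 → ℂ} (hf : ContDiff ℝ ∞ f) (j : Fin n) (k : ℕ) :
    ContDiff ℝ ∞ ((partialDeriv j)^[k] f) := by
  induction k generalizing f with
  | zero => exact hf
  | succ k ih => exact ih (contDiff_partialDeriv hf j)

theorem tsupport_iterate_partialDeriv_subset (f : 𝔼 → ℂ) (j : Fin n) (k : ℕ) :
    tsupport ((partialDeriv j)^[k] f) ⊆ tsupport f := by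
  induction k generalizing f with
  | zero => exact subset_rfl
  | succ k ih =>
    refine (ih (partialDeriv j f)).trans ?_
    refine closure_minimal (fun x hx => ?_) (isClosed_tsupport f)
    refine support_fderiv_subset ℝ (f := f) fun h => hx ?_
    simp [partialDeriv, h]

theorem hasCompactSupport_iterate_partialDeriv {f : 𝔼 → ℂ} (hf : HasCompactSupport f) (j : Fin n)
    (k : ℕ) : HasCompactSupport ((partialDeriv j)^[k] f) :=
  hf.mono' (subset_closure.trans (tsupport_iterate_partialDeriv_subset f j k))

theorem iterate_partialDeriv_add {f g : 𝔼 → ℂ} (hf : ContDiff ℝ ∞ f) (hg : ContDiff ℝ ∞ g)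
    (j : Fin n) (k : ℕ) :
    (partialDeriv j)^[k] (f + g) = (partialDeriv j)^[k] f + (partialDeriv j)^[k] g := by
  induction k generalizing f g with
  | zero => rfl
  | succ k ih =>
    have h : partialDeriv j (f + g) = partialDeriv j f + partialDeriv j g := by
      ext x
      simp only [partialDeriv, Pi.add_apply]
      rw [fderiv_add (hf.differentiable (by simp) x) (hg.differentiable (by simp) x)]
      rfl
    simp only [Function.iterate_succ_apply]
    rw [h, ih (contDiff_partialDeriv hf j) (contDiff_partialDeriv hg j)]

theorem partialDeriv_mul {f g : 𝔼 → ℂ} (hf : ContDiff ℝ ∞ f) (hg : ContDiff ℝ ∞ g) (j : Fin n) :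
    partialDeriv j (f * g) = partialDeriv j f * g + f * partialDeriv j g := by
  ext x
  simp only [partialDeriv, Pi.add_apply, Pi.mul_apply]
  rw [fderiv_mul (hf.differentiable (by simp) x) (hg.differentiable (by simp) x)]
  simp only [add_apply, smul_apply, smul_eq_mul]
  ring

/-- A form of Leibniz' rule: the `k`-th derivative of a product is a sum of `2 ^ k` products. -/
theorem norm_iterate_partialDeriv_mul_le {f g : 𝔼 → ℂ} (hf : ContDiff ℝ ∞ f)
    (hg : ContDiff ℝ ∞ g) (j : Fin n) (k : ℕ) (x : 𝔼) {B : ℝ}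
    (h : ∀ l m, l + m = k → ‖(partialDeriv j)^[l] f x‖ * ‖(partialDeriv j)^[m] g x‖ ≤ B) :
    ‖(partialDeriv j)^[k] (f * g) x‖ ≤ 2 ^ k * B := by
  induction k generalizing f g with
  | zero => simpa using h 0 0 rfl
  | succ k ih =>
    have hf' := contDiff_partialDeriv hf j
    have hg' := contDiff_partialDeriv hg j
    rw [Function.iterate_succ_apply, partialDeriv_mul hf hg,
      iterate_partialDeriv_add (f := partialDeriv j f * g) (g := f * partialDeriv j g)
        (hf'.mul hg) (hf.mul hg'), Pi.add_apply]
    have h1 := ih hf' hg fun l m hlm => h (l + 1) m (by omega)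
    have h2 := ih hf hg' fun l m hlm => h l (m + 1) (by omega)
    calc _ ≤ _ := norm_add_le _ _
      _ ≤ 2 ^ k * B + 2 ^ k * B := add_le_add h1 h2
      _ = 2 ^ (k + 1) * B := by ring

theorem iterate_partialDeriv_comp_smul (f : 𝔼 → ℂ) (j : Fin n) (k : ℕ) (r : ℝ) (x : 𝔼) :
    (partialDeriv j)^[k] (fun y => f (r • y)) x = r ^ k • (partialDeriv j)^[k] f (r • x) := by
  induction k generalizing x with
  | zero => simp
  | succ k ih =>
    have h : (partialDeriv j)^[k] (fun y => f (r • y))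
        = fun x => r ^ k • (partialDeriv j)^[k] f (r • x) := funext ih
    rw [Function.iterate_succ_apply', Function.iterate_succ_apply', h]
    simp only [partialDeriv]
    rw [show (fun x => r ^ k • (partialDeriv j)^[k] f (r • x))
      = r ^ k • fun x => (partialDeriv j)^[k] f (r • x) from rfl, fderiv_const_smul_field,
      Pi.smul_apply, fderiv_comp_smul (f := (partialDeriv j)^[k] f)]
    simp only [smul_apply, smul_smul, pow_succ]

theorem multiDeriv_single (j : Fin n) (k : ℕ) (f : 𝔼 → ℂ) :
    multiDeriv (Pi.single j k) f = (partialDeriv j)^[k] f := by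
  have key : ∀ l : List (Fin n), l.Nodup →
      l.foldr (fun i g => (partialDeriv i)^[(Pi.single j k : Fin n → ℕ) i] g) f
        = if j ∈ l then (partialDeriv j)^[k] f else f := by
    intro l
    induction l with
    | nil => simp
    | cons i l ih =>
      intro hl
      rw [List.nodup_cons] at hl
      rw [List.foldr_cons, ih hl.2]
      by_cases hij : i = j
      · subst hij
        simp [hl.1]
      · have : j ≠ i := Ne.symm hij
        simp [hij, this]
  exact (key _ (List.nodup_finRange n)).trans (by simp)

theorem multiLength_single (j : Fin n) (k : ℕ) : multiLength (Pi.single j k) = k := by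
  simp [multiLength]

theorem multiDeriv_zero (f : 𝔼 → ℂ) : multiDeriv 0 f = f := by
  simp [multiDeriv]

end PartialDerivatives

/-! ### Decay of oscillatory integrals -/

section OscillatoryIntegrals

variable {n : ℕ}

local notation "𝔼" => EuclideanSpace ℝ (Fin n)

theorem norm_exp_I_mul_inner (w ξ : 𝔼) :
    ‖Complex.exp (Complex.I * ((inner ℝ w ξ : ℝ) : ℂ))‖ = 1 := by
  rw [mul_comm]
  exact Complex.norm_exp_ofReal_mul_I _

theorem contDiff_exp_I_mul_inner (w : 𝔼) :
    ContDiff ℝ ∞ fun ξ : 𝔼 => Complex.exp (Complex.I * ((inner ℝ w ξ : ℝ) : ℂ)) :=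
  (contDiff_const.mul (Complex.ofRealCLM.contDiff.comp (contDiff_const.inner ℝ contDiff_id))).cexp

theorem fderiv_exp_I_mul_inner (w ξ : 𝔼) (j : Fin n) :
    fderiv ℝ (fun ξ : 𝔼 => Complex.exp (Complex.I * ((inner ℝ w ξ : ℝ) : ℂ))) ξ
      (EuclideanSpace.single j 1)
      = Complex.I * (w j : ℂ) * Complex.exp (Complex.I * ((inner ℝ w ξ : ℝ) : ℂ)) := by
  have h1 : HasFDerivAt (fun ξ : 𝔼 => ((inner ℝ w ξ : ℝ) : ℂ))
      (Complex.ofRealCLM.comp (innerSL ℝ w)) ξ :=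
    (Complex.ofRealCLM.comp (innerSL ℝ w)).hasFDerivAt
  rw [((h1.const_mul Complex.I).cexp).fderiv]
  simp [EuclideanSpace.inner_single_right]
  ring

/-- Integration by parts. -/
theorem norm_mul_integral_exp {f : 𝔼 → ℂ} (hf : ContDiff ℝ ∞ f) (hc : HasCompactSupport f)
    (w : 𝔼) (j : Fin n) :
    ‖∫ ξ, partialDeriv j f ξ * Complex.exp (Complex.I * ((inner ℝ w ξ : ℝ) : ℂ))‖
      = |w j| * ‖∫ ξ, f ξ * Complex.exp (Complex.I * ((inner ℝ w ξ : ℝ) : ℂ))‖ := by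
  have he := contDiff_exp_I_mul_inner w
  have hf' := contDiff_partialDeriv hf j
  have hc' : HasCompactSupport (partialDeriv j f) :=
    hasCompactSupport_iterate_partialDeriv hc j 1
  have h := integral_mul_fderiv_eq_neg_fderiv_mul_of_integrable (μ := (volume : Measure 𝔼))
    (f := f) (g := fun ξ : 𝔼 => Complex.exp (Complex.I * ((inner ℝ w ξ : ℝ) : ℂ)))
    (v := EuclideanSpace.single j 1)
    ((hf'.continuous.mul he.continuous).integrable_of_hasCompactSupport hc'.mul_right)
    (by
      simp only [fderiv_exp_I_mul_inner]
      exact (hf.continuous.mul (continuous_const.mul he.continuous)).integrable_of_hasCompactSupport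
        hc.mul_right)
    ((hf.continuous.mul he.continuous).integrable_of_hasCompactSupport hc.mul_right)
    (fun x _ => hf.differentiable (by simp) x) (fun x _ => he.differentiable (by simp) x)
  have h2 : ∫ ξ, partialDeriv j f ξ * Complex.exp (Complex.I * ((inner ℝ w ξ : ℝ) : ℂ))
      = -(Complex.I * (w j : ℂ)) *
        ∫ ξ, f ξ * Complex.exp (Complex.I * ((inner ℝ w ξ : ℝ) : ℂ)) := by
    rw [neg_mul, ← integral_const_mul, ← neg_eq_iff_eq_neg]
    simp only [partialDeriv]
    rw [← h]
    refine integral_congr_ae (ae_of_all _ fun ξ => ?_)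
    simp only [fderiv_exp_I_mul_inner]
    ring
  rw [h2]
  simp

theorem pow_mul_norm_integral_exp_le {f : 𝔼 → ℂ} (hf : ContDiff ℝ ∞ f) (hc : HasCompactSupport f)
    (w : 𝔼) (j : Fin n) (k : ℕ) :
    |w j| ^ k * ‖∫ ξ, f ξ * Complex.exp (Complex.I * ((inner ℝ w ξ : ℝ) : ℂ))‖
      ≤ ∫ ξ, ‖(partialDeriv j)^[k] f ξ‖ := by
  induction k generalizing f with
  | zero =>
    simp only [pow_zero, one_mul, Function.iterate_zero, id]
    refine (norm_integral_le_integral_norm _).trans_eq ?_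
    simp only [norm_mul, norm_exp_I_mul_inner, mul_one]
  | succ k ih =>
    have h := ih (contDiff_partialDeriv hf j) (hasCompactSupport_iterate_partialDeriv hc j 1)
    rw [norm_mul_integral_exp hf hc, ← mul_assoc, ← pow_succ] at h
    exact h

theorem exists_norm_le_mul_abs_apply (hn : n ≠ 0) (w : 𝔼) : ∃ j, ‖w‖ ≤ n * |w j| := by
  have : NeZero n := ⟨hn⟩
  obtain ⟨j, hj⟩ := Finite.exists_max fun i => |w i|
  refine ⟨j, ?_⟩
  have h1 : (1 : ℝ) ≤ n := by exact_mod_cast Nat.one_le_iff_ne_zero.2 hn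
  rw [EuclideanSpace.norm_eq, Real.sqrt_le_left (by positivity)]
  calc ∑ i, ‖w i‖ ^ 2 ≤ ∑ _i : Fin n, |w j| ^ 2 := by
        gcongr with i _
        exact hj i
    _ = n * |w j| ^ 2 := by simp
    _ ≤ (n * |w j|) ^ 2 := by
        rw [mul_pow]
        gcongr
        nlinarith

/-- Decay of an oscillatory integral with amplitude `b * θ`: the constant depends on the cutoff
`θ` only, and `b` enters through bounds of its pure derivatives on the support of `θ`. -/
theorem exists_norm_integral_exp_mul_le {θ : 𝔼 → ℂ} (hθ : ContDiff ℝ ∞ θ)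
    (hθc : HasCompactSupport θ) (N : ℕ) :
    ∃ C : ℝ, 0 ≤ C ∧ ∀ b : 𝔼 → ℂ, ContDiff ℝ ∞ b → ∀ B : ℝ,
      (∀ ξ ∈ tsupport θ, ‖b ξ‖ ≤ B) →
      (∀ ξ ∈ tsupport θ, ∀ j, ∀ l ≤ N, ‖(partialDeriv j)^[l] b ξ‖ ≤ B) → ∀ w : 𝔼,
      ‖∫ ξ, b ξ * θ ξ * Complex.exp (Complex.I * ((inner ℝ w ξ : ℝ) : ℂ))‖ * (1 + ‖w‖) ^ N
        ≤ C * B := by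
  obtain ⟨D, hD0, hD, hD'⟩ : ∃ D : ℝ, 0 ≤ D ∧ (∀ ξ, ‖θ ξ‖ ≤ D) ∧
      ∀ j, ∀ l ≤ N, ∀ ξ, ‖(partialDeriv j)^[l] θ ξ‖ ≤ D := by
    have h1 : ∀ j : Fin n, ∀ l : ℕ, ∃ D : ℝ, ∀ ξ, ‖(partialDeriv j)^[l] θ ξ‖ ≤ D := fun j l =>
      (contDiff_iterate_partialDeriv hθ j l).continuous.bounded_above_of_compact_support
        (hasCompactSupport_iterate_partialDeriv hθc j l)
    choose D₁ hD₁ using h1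
    obtain ⟨D₀, hD₀⟩ := hθ.continuous.bounded_above_of_compact_support hθc
    have hD₀0 : 0 ≤ D₀ := (norm_nonneg _).trans (hD₀ 0)
    have hD₁0 : ∀ j l, 0 ≤ D₁ j l := fun j l => (norm_nonneg _).trans (hD₁ j l 0)
    have hs : ∀ j, 0 ≤ ∑ l ∈ Finset.range (N + 1), D₁ j l := fun j =>
      Finset.sum_nonneg fun l _ => hD₁0 j l
    have hss : 0 ≤ ∑ j, ∑ l ∈ Finset.range (N + 1), D₁ j l := Finset.sum_nonneg fun j _ => hs j
    refine ⟨D₀ + ∑ j, ∑ l ∈ Finset.range (N + 1), D₁ j l, by positivity,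
      fun ξ => (hD₀ ξ).trans (by linarith), fun j l hl ξ => ?_⟩
    have e1 : D₁ j l ≤ ∑ l ∈ Finset.range (N + 1), D₁ j l :=
      Finset.single_le_sum (fun l _ => hD₁0 j l) (Finset.mem_range.2 (by omega))
    have e2 := Finset.single_le_sum (f := fun j => ∑ l ∈ Finset.range (N + 1), D₁ j l)
      (fun j _ => hs j) (Finset.mem_univ j)
    linarith [hD₁ j l ξ]
  set V : ℝ := volume.real (tsupport θ) with hV
  have hV0 : 0 ≤ V := measureReal_nonneg
  have hVfin : volume (tsupport θ) ≠ ⊤ := hθc.isCompact.measure_lt_top.ne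
  have hVm : MeasurableSet (tsupport θ) := (isClosed_tsupport θ).measurableSet
  refine ⟨(2 * (n + 1)) ^ N * (2 ^ N * D * V), by positivity, fun b hb B hb0 hbN w => ?_⟩
  -- If `θ = 0`, then `B` may be negative, but the integral and `V` vanish.
  rcases (tsupport θ).eq_empty_or_nonempty with hemp | ⟨ξ₀, hξ₀⟩
  · have h0 : ∀ ξ, θ ξ = 0 := fun ξ => image_eq_zero_of_notMem_tsupport (by simp [hemp])
    simp [h0, hV, hemp]
  have hB : 0 ≤ B := (norm_nonneg _).trans (hb0 ξ₀ hξ₀)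
  have hint : ∀ F : 𝔼 → ℂ, tsupport F ⊆ tsupport θ → (∀ ξ ∈ tsupport θ, ‖F ξ‖ ≤ 2 ^ N * (B * D)) →
      Continuous F → ∫ ξ, ‖F ξ‖ ≤ 2 ^ N * D * V * B := by
    intro F hs hF hFc
    have hFcs : HasCompactSupport F := hθc.mono' (subset_closure.trans hs)
    calc ∫ ξ, ‖F ξ‖ ≤ ∫ ξ, (tsupport θ).indicator (fun _ => 2 ^ N * (B * D)) ξ := by
          refine integral_mono (hFc.integrable_of_hasCompactSupport hFcs).norm
            ((integrable_indicator_iff hVm).2 (integrableOn_const hVfin)) fun ξ => ?_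
          by_cases hξ : ξ ∈ tsupport θ
          · simpa [hξ] using hF ξ hξ
          · have : F ξ = 0 := image_eq_zero_of_notMem_tsupport fun h => hξ (hs h)
            simp [hξ, this]
      _ = 2 ^ N * D * V * B := by
          rw [integral_indicator hVm, setIntegral_const, smul_eq_mul]
          ring
  have hbθ : ContDiff ℝ ∞ (b * θ) := hb.mul hθ
  have hbθc : HasCompactSupport (b * θ) := hθc.mul_left
  have hsub : tsupport (b * θ) ⊆ tsupport θ := tsupport_mul_subset_right
  set I : ℝ := ‖∫ ξ, b ξ * θ ξ * Complex.exp (Complex.I * ((inner ℝ w ξ : ℝ) : ℂ))‖ with hI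
  have hI0 : 0 ≤ I := norm_nonneg _
  have hQ0 : I ≤ 2 ^ N * D * V * B := by
    refine le_trans ?_ (hint (b * θ) hsub (fun ξ hξ => ?_) hbθ.continuous)
    · refine (norm_integral_le_integral_norm _).trans_eq ?_
      simp only [norm_mul, norm_exp_I_mul_inner, mul_one, Pi.mul_apply]
    · rw [Pi.mul_apply, norm_mul]
      calc ‖b ξ‖ * ‖θ ξ‖ ≤ 1 * (B * D) := by
            rw [one_mul]
            exact mul_le_mul (hb0 ξ hξ) (hD ξ) (norm_nonneg _) hB
        _ ≤ 2 ^ N * (B * D) := by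
            gcongr
            exact one_le_pow₀ (by norm_num)
  have hQN : ∀ j, |w j| ^ N * I ≤ 2 ^ N * D * V * B := by
    intro j
    refine (pow_mul_norm_integral_exp_le hbθ hbθc w j N).trans ?_
    refine hint _ ((tsupport_iterate_partialDeriv_subset _ j N).trans hsub) (fun ξ hξ => ?_)
      (contDiff_iterate_partialDeriv hbθ j N).continuous
    refine norm_iterate_partialDeriv_mul_le hb hθ j N ξ fun l m hlm => ?_
    exact mul_le_mul (hbN ξ hξ j l (by omega)) (hD' j m (by omega) ξ) (norm_nonneg _) hB
  have hQpos : 0 ≤ 2 ^ N * D * V * B := by positivity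
  have hn1 : (1 : ℝ) ≤ n + 1 := by linarith [(Nat.cast_nonneg n : (0 : ℝ) ≤ n)]
  rw [show (2 * ((n : ℝ) + 1)) ^ N * (2 ^ N * D * V) * B
    = (2 * ((n : ℝ) + 1)) ^ N * (2 ^ N * D * V * B) by ring, mul_comm I]
  rcases le_total ‖w‖ 1 with hw | hw
  · gcongr
    linarith
  · have hn : n ≠ 0 := by
      rintro rfl
      have : w = 0 := Subsingleton.elim _ _
      simp [this] at hw
      linarith
    obtain ⟨j, hj⟩ := exists_norm_le_mul_abs_apply hn w
    calc (1 + ‖w‖) ^ N * I ≤ (2 * ((n + 1) * |w j|)) ^ N * I := by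
          gcongr
          have := abs_nonneg (w j)
          nlinarith
      _ = (2 * ((n : ℝ) + 1)) ^ N * (|w j| ^ N * I) := by rw [mul_pow, mul_pow, mul_pow]; ring
      _ ≤ _ := by
          exact mul_le_mul_of_nonneg_left (hQN j) (by positivity)

theorem japaneseBracket_pos (ξ : 𝔼) : 0 < japaneseBracket ξ :=
  Real.sqrt_pos.2 (by positivity)

theorem one_le_japaneseBracket (ξ : 𝔼) : 1 ≤ japaneseBracket ξ := by
  rw [japaneseBracket, Real.one_le_sqrt]
  nlinarith [sq_nonneg ‖ξ‖]

theorem norm_le_japaneseBracket (ξ : 𝔼) : ‖ξ‖ ≤ japaneseBracket ξ := by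
  rw [japaneseBracket]
  exact Real.le_sqrt_of_sq_le (by linarith)

/-- The kernel of a symbol `a` of order `-1` localized by `θ(ξ / R)` to frequencies of size `R`
is bounded by a constant times `R⁻¹ * R ^ n * (1 + R * ‖w‖) ^ (-N)`, uniformly in `R`. -/
theorem exists_norm_integral_exp_dilate_le {θ : 𝔼 → ℂ} (hθ : ContDiff ℝ ∞ θ)
    (hθc : HasCompactSupport θ) (N : ℕ) :
    ∃ C : ℝ, 0 ≤ C ∧ ∀ R : ℝ, 0 < R → (∀ ξ ∈ tsupport θ, R / 2 ≤ japaneseBracket (R • ξ)) →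
      ∀ a : 𝔼 → ℂ, ContDiff ℝ ∞ a → ∀ B : ℝ, 0 ≤ B →
      (∀ ξ, ‖a ξ‖ ≤ B * japaneseBracket ξ ^ (-1 : ℝ)) →
      (∀ j, ∀ l ≤ N, ∀ ξ, ‖(partialDeriv j)^[l] a ξ‖ ≤ B * japaneseBracket ξ ^ (-1 - (l : ℝ))) →
      ∀ w : 𝔼,
      ‖∫ ξ, a ξ * θ (R⁻¹ • ξ) * Complex.exp (Complex.I * ((inner ℝ w ξ : ℝ) : ℂ))‖
          * (1 + R * ‖w‖) ^ N ≤ C * B * (R⁻¹ * R ^ n) := by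
  obtain ⟨C, hC0, hC⟩ := exists_norm_integral_exp_mul_le hθ hθc N
  refine ⟨C * 2 ^ (N + 1), by positivity, fun R hR hRθ a ha B hB ha0 haN w => ?_⟩
  -- Substitute `ξ = R • η`: the derivatives of `a (R • η)` are `O(R⁻¹)` on the support of `θ`.
  have hsub : ∫ ξ, a ξ * θ (R⁻¹ • ξ) * Complex.exp (Complex.I * ((inner ℝ w ξ : ℝ) : ℂ))
      = (R ^ n : ℝ) • ∫ η, a (R • η) * θ η
        * Complex.exp (Complex.I * ((inner ℝ (R • w) η : ℝ) : ℂ)) := by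
    have h := Measure.integral_comp_smul_of_nonneg (volume : Measure 𝔼)
      (fun ξ => a ξ * θ (R⁻¹ • ξ) * Complex.exp (Complex.I * ((inner ℝ w ξ : ℝ) : ℂ))) R
      (hR := hR.le)
    simp only [smul_smul, inv_mul_cancel₀ hR.ne', one_smul, finrank_euclideanSpace,
      Fintype.card_fin, inner_smul_right] at h
    simp only [inner_smul_left, RCLike.conj_to_real]
    rw [h, smul_smul, mul_inv_cancel₀ (by positivity), one_smul]
  have hbr : ∀ ξ ∈ tsupport θ, ∀ l : ℕ, l ≤ N →
      R ^ l * japaneseBracket (R • ξ) ^ (-1 - (l : ℝ)) ≤ 2 ^ (N + 1) * R⁻¹ := by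
    intro ξ hξ l hl
    have h1 : japaneseBracket (R • ξ) ^ (-1 - (l : ℝ)) ≤ (R / 2) ^ (-1 - (l : ℝ)) :=
      Real.rpow_le_rpow_of_nonpos (by positivity) (hRθ ξ hξ)
        (by linarith [(Nat.cast_nonneg l : (0 : ℝ) ≤ l)])
    have h2 : (R / 2) ^ (-1 - (l : ℝ)) = ((R / 2) ^ (l + 1))⁻¹ := by
      rw [show (-1 - (l : ℝ)) = -((l + 1 : ℕ) : ℝ) by push_cast; ring,
        Real.rpow_neg (by positivity), Real.rpow_natCast]
    rw [h2] at h1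
    calc R ^ l * japaneseBracket (R • ξ) ^ (-1 - (l : ℝ)) ≤ R ^ l * ((R / 2) ^ (l + 1))⁻¹ := by
          gcongr
      _ = 2 ^ (l + 1) * R⁻¹ := by
          rw [div_pow, inv_div, pow_succ R l]
          field_simp
      _ ≤ 2 ^ (N + 1) * R⁻¹ := by
          gcongr
          norm_num
  have hmain := hC (fun η => a (R • η)) (ha.comp (contDiff_const_smul R)) (B * (2 ^ (N + 1) * R⁻¹))
    (fun ξ hξ => by
      refine (ha0 _).trans ?_
      gcongr
      simpa using hbr ξ hξ 0 (Nat.zero_le _))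
    (fun ξ hξ j l hl => by
      rw [iterate_partialDeriv_comp_smul, norm_smul, norm_pow, Real.norm_of_nonneg hR.le]
      calc R ^ l * ‖(partialDeriv j)^[l] a (R • ξ)‖
          ≤ R ^ l * (B * japaneseBracket (R • ξ) ^ (-1 - (l : ℝ))) := by
            gcongr
            exact haN j l hl _
        _ = B * (R ^ l * japaneseBracket (R • ξ) ^ (-1 - (l : ℝ))) := by ring
        _ ≤ _ := mul_le_mul_of_nonneg_left (hbr ξ hξ l hl) hB) (R • w)
  rw [norm_smul R w, Real.norm_of_nonneg hR.le] at hmain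
  rw [hsub, norm_smul, Real.norm_of_nonneg (by positivity)]
  calc _ = R ^ n * (‖∫ η, a (R • η) * θ η
          * Complex.exp (Complex.I * ((inner ℝ (R • w) η : ℝ) : ℂ))‖ * (1 + R * ‖w‖) ^ N) := by ring
    _ ≤ R ^ n * (C * (B * (2 ^ (N + 1) * R⁻¹))) := by gcongr
    _ = _ := by ring

end OscillatoryIntegrals

/-! ### Frequency-localized operators -/

section LocalizedOperators

variable {n : ℕ}

local notation "𝔼" => EuclideanSpace ℝ (Fin n)

theorem IsSO₀.contDiff_right {c : 𝔼 → 𝔼 → ℂ} {m : ℝ} (hc : IsSO₀ m c) (x : 𝔼) :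
    ContDiff ℝ ∞ (c x) :=
  hc.isSO.symbol.smooth.comp (contDiff_const.prodMk contDiff_id)

theorem IsSO₀.continuous {c : 𝔼 → 𝔼 → ℂ} {m : ℝ} (hc : IsSO₀ m c) :
    Continuous (Function.uncurry c) :=
  hc.isSO.symbol.smooth.continuous

theorem symbolDeriv_zero_right (α : Fin n → ℕ) (c : 𝔼 → 𝔼 → ℂ) (x ξ : 𝔼) :
    symbolDeriv α 0 c x ξ = multiDeriv α (c x) ξ := by
  simp only [symbolDeriv, multiDeriv_zero]

/-- A single bounded function `M` that vanishes at infinity controls finitely many of the symbol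
estimates. -/
theorem IsSO₀.exists_bound {c : 𝔼 → 𝔼 → ℂ} {m : ℝ} (hc : IsSO₀ m c) (S : Finset (Fin n → ℕ)) :
    ∃ (M : 𝔼 → ℝ) (C : ℝ), (∀ x, 0 ≤ M x) ∧ (∀ x, M x ≤ C) ∧ Tendsto M (cocompact 𝔼) (𝓝 0) ∧
      ∀ α ∈ S, ∀ x ξ, ‖multiDeriv α (c x) ξ‖ ≤ M x * japaneseBracket ξ ^ (m - multiLength α) := by
  have h1 := fun α => hc.isSO.symbol.bound α 0
  have h2 := fun α => hc.decay α 0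
  simp only [DecaysAtInfinity, symbolDeriv_zero_right] at h1 h2
  choose C hC using h1
  choose K hK hK0 using h2
  have hpos : ∀ (ξ : 𝔼) (r : ℝ), 0 < japaneseBracket ξ ^ r := fun ξ r =>
    Real.rpow_pos_of_pos (japaneseBracket_pos ξ) r
  have hC' : ∀ α x ξ, ‖multiDeriv α (c x) ξ‖
      ≤ C α * japaneseBracket ξ ^ (m - multiLength α) := by
    intro α x ξ
    simpa [multiLength] using hC α x ξ
  have hCn : ∀ α, 0 ≤ C α := fun α =>
    nonneg_of_mul_nonneg_left ((norm_nonneg _).trans (hC' α 0 0)) (hpos _ _)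
  have hKn : ∀ α x, 0 ≤ K α x := fun α x =>
    nonneg_of_mul_nonneg_left ((norm_nonneg _).trans (hK α x 0)) (hpos _ _)
  have hCs : 0 ≤ ∑ α ∈ S, C α := Finset.sum_nonneg fun α _ => hCn α
  -- The functions `K α` need not be bounded, hence the minimum.
  refine ⟨fun x => min (∑ α ∈ S, C α) (∑ α ∈ S, K α x), ∑ α ∈ S, C α,
    fun x => le_min hCs (Finset.sum_nonneg fun α _ => hKn α x), fun x => min_le_left _ _, ?_, ?_⟩
  · have h := (tendsto_const_nhds (x := ∑ α ∈ S, C α) (f := cocompact 𝔼)).min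
      (tendsto_finsetSum S fun α _ => hK0 α)
    simpa [hCs] using h
  · intro α hα x ξ
    rw [← div_le_iff₀ (hpos _ _)]
    refine le_min ?_ ?_
    · exact ((div_le_iff₀ (hpos _ _)).2 (hC' α x ξ)).trans
        (Finset.single_le_sum (fun α _ => hCn α) hα)
    · exact ((div_le_iff₀ (hpos _ _)).2 (hK α x ξ)).trans
        (Finset.single_le_sum (f := fun α => K α x) (fun α _ => hKn α x) hα)

/-- The kernel of the pseudodifferential operator with symbol `c(x, ξ) θ(ξ / R)`. -/
noncomputable def localizedKernel (c : 𝔼 → 𝔼 → ℂ) (θ : 𝔼 → ℂ) (R : ℝ) (x y : 𝔼) : ℂ :=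
  (1 / (2 * (Real.pi : ℂ)) ^ n) *
    ∫ ξ, c x ξ * θ (R⁻¹ • ξ) * Complex.exp (Complex.I * ((inner ℝ (x - y) ξ : ℝ) : ℂ))

theorem norm_one_div_two_pi_pow_le : ‖(1 / (2 * (Real.pi : ℂ)) ^ n)‖ ≤ 1 := by
  rw [norm_div, norm_one, norm_pow, norm_mul, Complex.norm_ofNat, Complex.norm_real,
    Real.norm_of_nonneg Real.pi_pos.le]
  have : 1 ≤ 2 * Real.pi := by linarith [Real.pi_gt_three]
  exact div_le_one_of_le₀ (one_le_pow₀ this) (by positivity)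

theorem isCompact_smul_tsupport {θ : 𝔼 → ℂ} (hθc : HasCompactSupport θ) (R : ℝ) :
    IsCompact ((fun ξ : 𝔼 => R • ξ) '' tsupport θ) :=
  hθc.isCompact.image (continuous_const_smul R)

theorem eq_zero_of_notMem_smul_tsupport {θ : 𝔼 → ℂ} {R : ℝ} (hR : 0 < R) {ξ : 𝔼}
    (hξ : ξ ∉ (fun ξ : 𝔼 => R • ξ) '' tsupport θ) : θ (R⁻¹ • ξ) = 0 :=
  image_eq_zero_of_notMem_tsupport fun h => hξ ⟨_, h, by simp [smul_smul, hR.ne']⟩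

theorem continuous_localizedKernel {c : 𝔼 → 𝔼 → ℂ} (hc : Continuous (Function.uncurry c))
    {θ : 𝔼 → ℂ} (hθ : Continuous θ) (hθc : HasCompactSupport θ) {R : ℝ} (hR : 0 < R) :
    Continuous (Function.uncurry (localizedKernel c θ R)) := by
  have hcont : Continuous (Function.uncurry fun (z : 𝔼 × 𝔼) (ξ : 𝔼) => c z.1 ξ * θ (R⁻¹ • ξ)
      * Complex.exp (Complex.I * ((inner ℝ (z.1 - z.2) ξ : ℝ) : ℂ))) := by
    have h1 : Continuous fun p : (𝔼 × 𝔼) × 𝔼 => c p.1.1 p.2 :=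
      hc.comp ((continuous_fst.comp continuous_fst).prodMk continuous_snd)
    have h2 : Continuous fun p : (𝔼 × 𝔼) × 𝔼 => inner ℝ (p.1.1 - p.1.2) p.2 := by fun_prop
    exact (h1.mul (by fun_prop)).mul
      (continuous_const.mul (Complex.continuous_ofReal.comp h2)).cexp
  have h := continuous_parametric_integral_of_continuous (μ := (volume : Measure 𝔼)) hcont
    (isCompact_smul_tsupport hθc R)
  have he : ∀ z : 𝔼 × 𝔼, ∫ ξ in (fun ξ : 𝔼 => R • ξ) '' tsupport θ, c z.1 ξ * θ (R⁻¹ • ξ)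
      * Complex.exp (Complex.I * ((inner ℝ (z.1 - z.2) ξ : ℝ) : ℂ))
      = ∫ ξ, c z.1 ξ * θ (R⁻¹ • ξ)
      * Complex.exp (Complex.I * ((inner ℝ (z.1 - z.2) ξ : ℝ) : ℂ)) := fun z =>
    setIntegral_eq_integral_of_forall_compl_eq_zero fun ξ hξ => by
      simp [eq_zero_of_notMem_smul_tsupport hR hξ]
  simp only [he] at h
  exact continuous_const.mul h

theorem integrable_inv_one_add_norm_pow :
    Integrable fun w : 𝔼 => ((1 + ‖w‖) ^ (n + 1))⁻¹ := by
  have h := integrable_one_add_norm (E := 𝔼) (μ := volume) (r := ((n + 1 : ℕ) : ℝ)) (by simp)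
  refine h.congr (ae_of_all _ fun w => ?_)
  simp only
  rw [Real.rpow_neg (by positivity), Real.rpow_natCast]

/-- The part of `Op(c)` at frequencies of size `R` is compact, with norm `O(R⁻¹)`. -/
theorem IsSO₀.exists_localizedOperator {c : 𝔼 → 𝔼 → ℂ} (hc : IsSO₀ (-1) c) {q : ℝ≥0∞}
    [Fact (1 ≤ q)] (hq₁ : 1 < q) (hq : q < ⊤) {θ : 𝔼 → ℂ} (hθ : ContDiff ℝ ∞ θ)
    (hθc : HasCompactSupport θ) :
    ∃ A : ℝ, ∀ R : ℝ, 0 < R → (∀ ξ ∈ tsupport θ, R / 2 ≤ japaneseBracket (R • ξ)) →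
      ∃ T : Lp ℂ q (volume : Measure 𝔼) →L[ℂ] Lp ℂ q (volume : Measure 𝔼),
        IsIntegralOperator (localizedKernel c θ R) T ∧ IsCompactOperator T ∧ ‖T‖ ≤ A * R⁻¹ := by
  classical
  obtain ⟨M, C, hM0, hMC, hM, hMb⟩ := hc.exists_bound (insert 0
    ((Finset.univ ×ˢ Finset.range (n + 2)).image fun p : Fin n × ℕ => Pi.single p.1 p.2))
  obtain ⟨D, hD0, hD⟩ := exists_norm_integral_exp_dilate_le hθ hθc (n + 1)
  refine ⟨C * (D * ∫ w : 𝔼, ((1 + ‖w‖) ^ (n + 1))⁻¹), fun R hR hRθ => ?_⟩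
  let k : 𝔼 → ℝ := fun z => D * (R⁻¹ * R ^ n) * ((1 + ‖R • z‖) ^ (n + 1))⁻¹
  have hk0 : ∀ z, 0 ≤ k z := fun z => by positivity
  have hkm : Measurable k := by
    refine Continuous.measurable (continuous_const.mul (Continuous.inv₀ (by fun_prop) fun z => ?_))
    positivity
  have hki : Integrable k :=
    ((integrable_comp_smul_iff volume (fun w : 𝔼 => ((1 + ‖w‖) ^ (n + 1))⁻¹) hR.ne').2
      integrable_inv_one_add_norm_pow).const_mul _
  have hkint : ∫ z, k z = D * (∫ w : 𝔼, ((1 + ‖w‖) ^ (n + 1))⁻¹) * R⁻¹ := by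
    have h := Measure.integral_comp_smul_of_nonneg (volume : Measure 𝔼)
      (fun w : 𝔼 => ((1 + ‖w‖) ^ (n + 1))⁻¹) R (hR := hR.le)
    simp only [finrank_euclideanSpace, Fintype.card_fin, smul_eq_mul] at h
    simp only [k]
    rw [integral_const_mul, h]
    field_simp
  have hGk : ∀ x y, ‖localizedKernel c θ R x y‖ ≤ M x * k (x - y) := by
    intro x y
    have h := hD R hR hRθ (c x) (hc.contDiff_right x) (M x) (hM0 x)
      (fun ξ => by
        have := hMb 0 (Finset.mem_insert_self _ _) x ξ
        simpa [multiDeriv_zero, multiLength] using this)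
      (fun j l hl ξ => by
        have := hMb (Pi.single j l) (Finset.mem_insert_of_mem (Finset.mem_image.2
          ⟨(j, l), by simp; omega, rfl⟩)) x ξ
        rwa [multiDeriv_single, multiLength_single] at this) (x - y)
    have hpos : (0 : ℝ) < (1 + R * ‖x - y‖) ^ (n + 1) := by positivity
    rw [← le_div_iff₀ hpos] at h
    rw [localizedKernel, norm_mul]
    refine (mul_le_of_le_one_left (norm_nonneg _) norm_one_div_two_pi_pow_le).trans (h.trans_eq ?_)
    simp only [k]
    rw [norm_smul, Real.norm_of_nonneg hR.le]
    ring
  have hcont := continuous_localizedKernel hc.continuous hθ.continuous hθc hR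
  have hdom : IsDominatedKernel (localizedKernel c θ R) (fun z => C * k z) :=
    ⟨hcont.measurable, hkm.const_mul C, hki.const_mul C, fun x y => (hGk x y).trans
      (mul_le_mul_of_nonneg_right (hMC x) (hk0 _))⟩
  obtain ⟨T, hT, hTn⟩ := hdom.exists_isIntegralOperator hq₁ hq
  refine ⟨T, hT, hT.isCompactOperator hq₁ hq hcont hMC hM hki hkm hk0 hGk, hTn.trans_eq ?_⟩
  rw [integral_const_mul, hkint]
  ring

end LocalizedOperators

/-! ### The dyadic partition of unity -/

section DyadicDecomposition

variable {n : ℕ}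

local notation "𝔼" => EuclideanSpace ℝ (Fin n)

/-- A smooth cutoff function: `1` on the unit ball, `0` outside the ball of radius `2`. -/
noncomputable def cutoff (n : ℕ) (ξ : EuclideanSpace ℝ (Fin n)) : ℂ :=
  ((⟨1, 2, one_pos, one_lt_two⟩ : ContDiffBump (0 : EuclideanSpace ℝ (Fin n))) ξ : ℝ)

theorem contDiff_cutoff : ContDiff ℝ ∞ (cutoff n) :=
  Complex.ofRealCLM.contDiff.comp (ContDiffBump.contDiff _)

theorem hasCompactSupport_cutoff : HasCompactSupport (cutoff n) :=
  (ContDiffBump.hasCompactSupport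
    (⟨1, 2, one_pos, one_lt_two⟩ : ContDiffBump (0 : 𝔼))).comp_left Complex.ofReal_zero

theorem cutoff_eq_one {ξ : 𝔼} (hξ : ‖ξ‖ ≤ 1) : cutoff n ξ = 1 := by
  rw [cutoff, ContDiffBump.one_of_mem_closedBall _ (by simpa using hξ), Complex.ofReal_one]

theorem norm_cutoff_le (ξ : 𝔼) : ‖cutoff n ξ‖ ≤ 1 := by
  rw [cutoff, Complex.norm_real, Real.norm_of_nonneg (ContDiffBump.nonneg _)]
  exact ContDiffBump.le_one _

/-- The generator of the dyadic partition of unity; it is supported in `1 / 2 ≤ ‖ξ‖ ≤ 2`. -/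
noncomputable def annulusCutoff (n : ℕ) (ξ : EuclideanSpace ℝ (Fin n)) : ℂ :=
  cutoff n ξ - cutoff n ((2 : ℝ) • ξ)

theorem contDiff_annulusCutoff : ContDiff ℝ ∞ (annulusCutoff n) :=
  contDiff_cutoff.sub (contDiff_cutoff.comp (contDiff_const_smul _))

theorem hasCompactSupport_annulusCutoff : HasCompactSupport (annulusCutoff n) :=
  hasCompactSupport_cutoff.sub (hasCompactSupport_cutoff.comp_smul two_ne_zero)

theorem half_le_norm_of_mem_tsupport_annulusCutoff {ξ : 𝔼} (hξ : ξ ∈ tsupport (annulusCutoff n)) :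
    1 / 2 ≤ ‖ξ‖ := by
  have hcl : IsClosed {ξ : 𝔼 | 1 / 2 ≤ ‖ξ‖} := isClosed_le continuous_const continuous_norm
  refine closure_minimal (fun η hη => ?_) hcl hξ
  by_contra hlt
  have hlt' : ‖η‖ < 1 / 2 := not_le.1 hlt
  refine hη ?_
  rw [annulusCutoff, cutoff_eq_one (by linarith), cutoff_eq_one, sub_self]
  rw [norm_smul, Real.norm_ofNat]
  linarith

/-- The unscaled cutoff functions of the dyadic decomposition: the `j`-th one is applied
to `ξ / 2 ^ j`. -/
noncomputable def dyadicCutoff (n j : ℕ) : EuclideanSpace ℝ (Fin n) → ℂ :=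
  if j = 0 then cutoff n else annulusCutoff n

theorem contDiff_dyadicCutoff (j : ℕ) : ContDiff ℝ ∞ (dyadicCutoff n j) := by
  unfold dyadicCutoff
  split_ifs
  exacts [contDiff_cutoff, contDiff_annulusCutoff]

theorem hasCompactSupport_dyadicCutoff (j : ℕ) : HasCompactSupport (dyadicCutoff n j) := by
  unfold dyadicCutoff
  split_ifs
  exacts [hasCompactSupport_cutoff, hasCompactSupport_annulusCutoff]

theorem half_le_japaneseBracket_of_mem_tsupport {j : ℕ} {ξ : 𝔼}
    (hξ : ξ ∈ tsupport (dyadicCutoff n j)) :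
    (2 : ℝ) ^ j / 2 ≤ japaneseBracket ((2 : ℝ) ^ j • ξ) := by
  by_cases hj : j = 0
  · subst hj
    exact le_trans (by norm_num) (one_le_japaneseBracket _)
  · rw [dyadicCutoff, if_neg hj] at hξ
    refine le_trans ?_ (norm_le_japaneseBracket _)
    rw [norm_smul, Real.norm_of_nonneg (by positivity)]
    have := half_le_norm_of_mem_tsupport_annulusCutoff hξ
    have h2 : (0 : ℝ) < 2 ^ j := by positivity
    nlinarith

theorem sum_dyadicCutoff (J : ℕ) (ξ : 𝔼) :
    ∑ j ∈ Finset.range (J + 1), dyadicCutoff n j (((2 : ℝ) ^ j)⁻¹ • ξ)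
      = cutoff n (((2 : ℝ) ^ J)⁻¹ • ξ) := by
  induction J with
  | zero => simp [dyadicCutoff]
  | succ J ih =>
    rw [Finset.sum_range_succ, ih, dyadicCutoff, if_neg (Nat.succ_ne_zero J), annulusCutoff,
      smul_smul]
    have : (2 : ℝ) * (2 ^ (J + 1))⁻¹ = (2 ^ J)⁻¹ := by
      rw [pow_succ]
      field_simp
    rw [this]
    ring

theorem tendsto_cutoff_dilate (ξ : 𝔼) :
    Tendsto (fun J : ℕ => cutoff n (((2 : ℝ) ^ J)⁻¹ • ξ)) atTop (𝓝 1) := by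
  refine tendsto_const_nhds.congr' ?_
  filter_upwards [(tendsto_pow_atTop_atTop_of_one_lt (one_lt_two : (1 : ℝ) < 2)).eventually_ge_atTop
    ‖ξ‖] with J hJ
  refine (cutoff_eq_one ?_).symm
  rw [norm_smul, norm_inv, Real.norm_of_nonneg (by positivity), inv_mul_le_iff₀ (by positivity),
    mul_one]
  exact hJ

end DyadicDecomposition

/-! ### Summation of the localized operators -/

section Extension

variable {n : ℕ}

local notation "𝔼" => EuclideanSpace ℝ (Fin n)

theorem continuous_op_integrand {c : 𝔼 → 𝔼 → ℂ} {m : ℝ} (hc : IsSO₀ m c) {u : 𝔼 → ℂ}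
    (hu : Continuous u) (x : 𝔼) : Continuous fun p : 𝔼 × 𝔼 =>
      c x p.2 * u p.1 * Complex.exp (Complex.I * ((inner ℝ (x - p.1) p.2 : ℝ) : ℂ)) := by
  have h1 : Continuous fun p : 𝔼 × 𝔼 => c x p.2 :=
    (hc.contDiff_right x).continuous.comp continuous_snd
  have h2 : Continuous fun p : 𝔼 × 𝔼 => inner ℝ (x - p.1) p.2 := by fun_prop
  exact (h1.mul (by fun_prop)).mul (continuous_const.mul (Complex.continuous_ofReal.comp h2)).cexp

/-- The outer integral in the definition of `Op c u` converges absolutely: the inner one is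
`c(x, ξ)` times the Fourier transform of `u`, up to a factor of modulus one. -/
theorem integrable_op_integrand {c : 𝔼 → 𝔼 → ℂ} (hc : IsSO₀ (-1) c) {u : 𝔼 → ℂ}
    (hu : ContDiff ℝ ∞ u) (huc : HasCompactSupport u) (x : 𝔼) :
    Integrable fun ξ => ∫ y, c x ξ * u y
      * Complex.exp (Complex.I * ((inner ℝ (x - y) ξ : ℝ) : ℂ)) := by
  obtain ⟨M, C, hM0, -, -, hM⟩ := hc.exists_bound {0}
  have hcx : ∀ ξ, ‖c x ξ‖ ≤ M x := by
    intro ξ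
    have h := hM 0 (Finset.mem_singleton_self _) x ξ
    rw [multiDeriv_zero] at h
    refine h.trans (mul_le_of_le_one_right (hM0 x) ?_)
    exact Real.rpow_le_one_of_one_le_of_nonpos (one_le_japaneseBracket ξ) (by simp [multiLength])
  obtain ⟨D, hD0, hD⟩ := exists_norm_integral_exp_mul_le hu huc (n + 1)
  have hone : ∀ (j : Fin n) (l : ℕ) (ξ : 𝔼), ‖(partialDeriv j)^[l] (fun _ => (1 : ℂ)) ξ‖ ≤ 1 := by
    intro j l ξ
    have h0 : partialDeriv j (fun _ : 𝔼 => (1 : ℂ)) = 0 := by ext; simp [partialDeriv]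
    have h1 : partialDeriv j (0 : 𝔼 → ℂ) = 0 := by ext; simp [partialDeriv]
    cases l with
    | zero => simp
    | succ l => simp [Function.iterate_succ_apply, h0, Function.iterate_fixed h1]
  have hdecay := hD (fun _ => 1) contDiff_const 1 (fun _ _ => by simp) (fun ξ _ j l _ => hone j l ξ)
  refine (integrable_inv_one_add_norm_pow.const_mul (M x * D)).mono' ?_ (ae_of_all _ fun ξ => ?_)
  · have h : StronglyMeasurable fun p : 𝔼 × 𝔼 => c x p.1 * u p.2
        * Complex.exp (Complex.I * ((inner ℝ (x - p.2) p.1 : ℝ) : ℂ)) :=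
      ((continuous_op_integrand hc hu.continuous x).comp continuous_swap).stronglyMeasurable
    exact (h.integral_prod_right' (ν := volume)).aestronglyMeasurable
  · have he : ∀ y, c x ξ * u y * Complex.exp (Complex.I * ((inner ℝ (x - y) ξ : ℝ) : ℂ))
        = c x ξ * Complex.exp (Complex.I * ((inner ℝ x ξ : ℝ) : ℂ))
          * (1 * u y * Complex.exp (Complex.I * ((inner ℝ (-ξ) y : ℝ) : ℂ))) := by
      intro y
      rw [inner_sub_left, inner_neg_left, real_inner_comm y ξ, sub_eq_add_neg, Complex.ofReal_add,
        mul_add, Complex.exp_add]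
      ring
    simp only [he]
    rw [integral_const_mul, norm_mul, norm_mul, norm_exp_I_mul_inner, mul_one, mul_assoc]
    have h := hdecay (-ξ)
    rw [norm_neg, mul_one, ← le_div_iff₀ (by positivity), div_eq_mul_inv] at h
    exact mul_le_mul (hcx ξ) h (norm_nonneg _) (hM0 x)

/-- By Fubini's theorem, the integral operator with kernel `localizedKernel c θ R` is obtained from
`Op c` by inserting the cutoff `θ(ξ / R)`. -/
theorem integral_localizedKernel_mul {c : 𝔼 → 𝔼 → ℂ} {m : ℝ} (hc : IsSO₀ m c) {θ : 𝔼 → ℂ}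
    (hθ : Continuous θ) (hθc : HasCompactSupport θ) {R : ℝ} (hR : 0 < R) {u : 𝔼 → ℂ}
    (hu : Continuous u) (huc : HasCompactSupport u) (x : 𝔼) :
    ∫ y, localizedKernel c θ R x y * u y
      = (1 / (2 * (Real.pi : ℂ)) ^ n) * ∫ ξ, θ (R⁻¹ • ξ) * ∫ y, c x ξ * u y
      * Complex.exp (Complex.I * ((inner ℝ (x - y) ξ : ℝ) : ℂ)) := by
  have hcont : Continuous (Function.uncurry fun y ξ : 𝔼 => θ (R⁻¹ • ξ) * (c x ξ * u y
      * Complex.exp (Complex.I * ((inner ℝ (x - y) ξ : ℝ) : ℂ)))) :=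
    (show Continuous fun p : 𝔼 × 𝔼 => θ (R⁻¹ • p.2) by fun_prop).mul
      (continuous_op_integrand hc hu x)
  have hsupp : HasCompactSupport (Function.uncurry fun y ξ : 𝔼 => θ (R⁻¹ • ξ) * (c x ξ * u y
      * Complex.exp (Complex.I * ((inner ℝ (x - y) ξ : ℝ) : ℂ)))) := by
    refine HasCompactSupport.intro (huc.isCompact.prod (isCompact_smul_tsupport hθc R)) ?_
    rintro ⟨y, ξ⟩ hyξ
    rw [Set.mem_prod, not_and_or] at hyξ
    rcases hyξ with hy | hξ
    · simp [image_eq_zero_of_notMem_tsupport hy]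
    · simp [eq_zero_of_notMem_smul_tsupport hR hξ]
  have hswap := integral_integral_swap_of_hasCompactSupport (μ := (volume : Measure 𝔼))
    (ν := (volume : Measure 𝔼)) hcont hsupp
  simp only [integral_const_mul] at hswap
  rw [← hswap, ← integral_const_mul]
  refine integral_congr_ae (ae_of_all _ fun y => ?_)
  simp only [localizedKernel]
  rw [mul_assoc, ← integral_mul_const]
  congr 1
  refine integral_congr_ae (ae_of_all _ fun ξ => ?_)
  ring

/-- The localized operators applied to a test function sum up to `Op(c) u`, pointwise. -/
theorem tendsto_sum_integral_localizedKernel {c : 𝔼 → 𝔼 → ℂ} (hc : IsSO₀ (-1) c) {u : 𝔼 → ℂ}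
    (hu : ContDiff ℝ ∞ u) (huc : HasCompactSupport u) (x : 𝔼) :
    Tendsto (fun J => ∑ j ∈ Finset.range (J + 1),
      ∫ y, localizedKernel c (dyadicCutoff n j) (2 ^ j) x y * u y) atTop (𝓝 (Op c u x)) := by
  set F : 𝔼 → ℂ := fun ξ => ∫ y, c x ξ * u y
    * Complex.exp (Complex.I * ((inner ℝ (x - y) ξ : ℝ) : ℂ)) with hF
  have hFi : Integrable F := integrable_op_integrand hc hu huc x
  have hmeas : ∀ {θ : 𝔼 → ℂ} (R : ℝ), Continuous θ →
      AEStronglyMeasurable (fun ξ => θ (R • ξ)) (volume : Measure 𝔼) := fun R hθ =>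
    (hθ.comp (continuous_const_smul R)).aestronglyMeasurable
  have hint : ∀ j : ℕ, Integrable fun ξ => dyadicCutoff n j (((2 : ℝ) ^ j)⁻¹ • ξ) * F ξ := by
    intro j
    have hθ := (contDiff_dyadicCutoff (n := n) j).continuous
    obtain ⟨D, hD⟩ := hθ.bounded_above_of_compact_support (hasCompactSupport_dyadicCutoff j)
    exact hFi.bdd_mul (c := D) (hmeas _ hθ) (ae_of_all _ fun ξ => hD _)
  have hsum : ∀ J : ℕ, ∑ j ∈ Finset.range (J + 1),
      ∫ y, localizedKernel c (dyadicCutoff n j) (2 ^ j) x y * u y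
      = (1 / (2 * (Real.pi : ℂ)) ^ n) * ∫ ξ, cutoff n (((2 : ℝ) ^ J)⁻¹ • ξ) * F ξ := by
    intro J
    simp only [← sum_dyadicCutoff, Finset.sum_mul]
    rw [integral_finsetSum _ fun j _ => hint j, Finset.mul_sum]
    exact Finset.sum_congr rfl fun j _ =>
      integral_localizedKernel_mul hc (contDiff_dyadicCutoff j).continuous
        (hasCompactSupport_dyadicCutoff j) (by positivity) hu.continuous huc x
  simp only [hsum]
  refine Tendsto.const_mul _ ?_
  refine tendsto_integral_of_dominated_convergence (fun ξ => ‖F ξ‖)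
    (fun J => (hmeas _ contDiff_cutoff.continuous).mul hFi.aestronglyMeasurable) hFi.norm
    (fun J => ae_of_all _ fun ξ => ?_) (ae_of_all _ fun ξ => ?_)
  · rw [norm_mul]
    exact mul_le_of_le_one_left (norm_nonneg _) (norm_cutoff_le _)
  · simpa using (tendsto_cutoff_dilate ξ).mul_const (F ξ)

theorem ExtendsOp.unique {c : 𝔼 → 𝔼 → ℂ} {q : ℝ≥0∞} [Fact (1 ≤ q)] (hq : q < ⊤)
    {T T' : Lp ℂ q (volume : Measure 𝔼) →L[ℂ] Lp ℂ q (volume : Measure 𝔼)}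
    (hT : ExtendsOp c T) (hT' : ExtendsOp c T') : T' = T := by
  refine ContinuousLinearMap.ext fun f => ?_
  refine congrFun (Continuous.ext_on (Lp.dense_hasCompactSupport_contDiff hq.ne) T'.continuous
    T.continuous ?_) f
  rintro f ⟨u, hfu, huc, hu⟩
  have hf : f = (hu.continuous.memLp_of_hasCompactSupport huc).toLp u :=
    Lp.ext (hfu.trans (MemLp.coeFn_toLp _).symm)
  rw [hf]
  exact Lp.ext ((hT' u hu huc).trans (hT u hu huc).symm)

/-- A symbol of class `SO_0^{-1}` defines a compact operator: the localized operators sum up in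
operator norm. -/
theorem IsSO₀.exists_extendsOp {c : 𝔼 → 𝔼 → ℂ} (hc : IsSO₀ (-1) c) {q : ℝ≥0∞}
    [Fact (1 ≤ q)] (hq₁ : 1 < q) (hq : q < ⊤) :
    ∃ T : Lp ℂ q (volume : Measure 𝔼) →L[ℂ] Lp ℂ q (volume : Measure 𝔼),
      ExtendsOp c T ∧ IsCompactOperator T := by
  obtain ⟨A, hA⟩ : ∃ A : ℝ, ∀ j : ℕ,
      ∃ T : Lp ℂ q (volume : Measure 𝔼) →L[ℂ] Lp ℂ q (volume : Measure 𝔼),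
        IsIntegralOperator (localizedKernel c (dyadicCutoff n j) (2 ^ j)) T ∧
        IsCompactOperator T ∧ ‖T‖ ≤ A * ((2 : ℝ) ^ j)⁻¹ := by
    have h := fun j : ℕ => hc.exists_localizedOperator hq₁ hq (contDiff_dyadicCutoff (n := n) j)
      (hasCompactSupport_dyadicCutoff j)
    choose A hA using h
    -- The cutoff functions with `j ≥ 1` all coincide, so two constants suffice.
    refine ⟨max (A 0) (A 1), fun j => ?_⟩
    have hj : ∃ i, A i ≤ max (A 0) (A 1) ∧ dyadicCutoff n j = dyadicCutoff n i := by
      by_cases hj : j = 0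
      · exact ⟨0, le_max_left _ _, by rw [hj]⟩
      · exact ⟨1, le_max_right _ _, by simp [dyadicCutoff, hj]⟩
    obtain ⟨i, hAi, hi⟩ := hj
    obtain ⟨T, hT, hTc, hTn⟩ := hA i (2 ^ j) (by positivity)
      fun ξ hξ => half_le_japaneseBracket_of_mem_tsupport (by rwa [hi])
    refine ⟨T, by rwa [hi], hTc, hTn.trans ?_⟩
    gcongr
  choose T hT hTc hTn using hA
  have hsn : Summable fun j => ‖T j‖ := by
    refine Summable.of_nonneg_of_le (fun _ => norm_nonneg _) hTn (Summable.mul_left A ?_)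
    simpa using summable_geometric_two
  have hs : Summable T := hsn.of_norm
  refine ⟨∑' j, T j, fun u hu huc => ?_, ?_⟩
  · set f := (hu.continuous.memLp_of_hasCompactSupport huc (p := q)
      (μ := (volume : Measure 𝔼))).toLp u with hf
    have hfu : f =ᵐ[volume] u := MemLp.coeFn_toLp _
    have hTf : (∑' j, T j) f = ∑' j, T j f :=
      ((ContinuousLinearMap.apply ℂ _ f).hasSum hs.hasSum).tsum_eq.symm
    have hsf : Summable fun j => ‖T j f‖ :=
      Summable.of_nonneg_of_le (fun _ => norm_nonneg _) (fun j => (T j).le_opNorm f)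
        (hsn.mul_right _)
    have hen : ∑' j, ‖T j f‖ₑ ≠ ⊤ := by
      simp only [← ofReal_norm]
      exact hsf.tsum_ofReal_ne_top
    rw [hTf]
    filter_upwards [Lp.hasSum_coeFn_tsum hen, ae_all_iff.2 fun j => hT j f] with x hx hTx
    refine tendsto_nhds_unique ((tendsto_add_atTop_iff_nat 1).2 hx.tendsto_sum_nat) ?_
    refine (tendsto_sum_integral_localizedKernel hc hu huc x).congr fun J => ?_
    refine Finset.sum_congr rfl fun j _ => ?_
    rw [hTx j]
    refine integral_congr_ae ?_
    filter_upwards [hfu] with y hy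
    rw [hy]
  · refine isCompactOperator_of_tendsto hs.hasSum (Eventually.of_forall fun S => ?_)
    exact Submodule.sum_mem (compactOperator (RingHom.id ℂ) (Lp ℂ q (volume : Measure 𝔼))
      (Lp ℂ q (volume : Measure 𝔼))) fun j _ => hTc j

end Extension

end PDO

theorem mainTheorem3 (n : ℕ) (q : ℝ≥0∞) [Fact (1 ≤ q)] (hq₁ : 1 < q) (hq : q < ⊤)
    (c : EuclideanSpace ℝ (Fin n) → EuclideanSpace ℝ (Fin n) → ℂ) (hc : PDO.IsSO₀ (-1) c) :
    ∃ T : Lp ℂ q (volume : Measure (EuclideanSpace ℝ (Fin n))) →L[ℂ]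
        Lp ℂ q (volume : Measure (EuclideanSpace ℝ (Fin n))),
      PDO.ExtendsOp c T ∧ (∀ T', PDO.ExtendsOp c T' → T' = T) ∧ IsCompactOperator T := by
  obtain ⟨T, hT, hTc⟩ := hc.exists_extendsOp hq₁ hq
  exact ⟨T, hT, fun T' hT' => hT.unique hq hT', hTc⟩
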